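/- Consider the real three-user Gaussian interference channel with receiver outputs $$Y_j(i)=X_j(i)+\sum_{k\ne j}h_{jk}X_k(i)+Z_j(i),\qquad j\in\{1,2,3\},$$ where $(Z_j(i))_i$ are i.i.d. $\mathcal N(0,\sigma_j^2)$ with $\sigma_j>0$, independent of the inputs, transmitter $k$ is subject to the power constraint $\frac1n\sum_{i=1}^nX_k(i)^2\le P_k$ with $P_k>0$ on every codeword of block length $n$, and the direct gains are $h_{jj}=1$. A triple $(R_1,R_2,R_3)$ of nonnegative numbers is called achievable if for all $\delta,\varepsilon>0$ and all sufficiently large $n$ there are encoders of block length $n$ satisfying the power constraints, with at least $2^{n(R_k-\delta)}$ messages for user $k$ ($k=1,2,3$), and decoders such that, for independent uniformly distributed messages, each receiver $j$ recovers message $j$ from its own output with error probability at most $\varepsilon$. Suppose that $h_{21},h_{32},h_{13}\neq0$ and $$\frac{h_{12}}{h_{21}}\cdot\frac{h_{23}}{h_{32}}\cdot\frac{h_{31}}{h_{13}}=\frac pq$$ with coprime integers $p,q$, $q\ne0$, and that at least one of the following three sets of inequalities holds: (1) $h_{12}^2\ge p^2\frac{P_1+\sigma_1^2}{\sigma_2^2}$,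 $h_{13}^2\ge\frac{P_1+\sigma_1^2}{\sigma_3^2}$, $h_{21}^2\ge q^2\frac{P_2+\sigma_2^2}{\sigma_1^2}$, $h_{23}^2\ge\frac{P_2+\sigma_2^2}{\sigma_3^2}$, $h_{31}^2\ge\frac{P_3+\sigma_3^2}{\sigma_1^2}$, $h_{32}^2\ge\frac{P_3+\sigma_3^2}{\sigma_2^2}$; (2) $h_{12}^2\ge\frac{P_1+\sigma_1^2}{\sigma_2^2}$, $h_{13}^2\ge\frac{P_1+\sigma_1^2}{\sigma_3^2}$, $h_{21}^2\ge\frac{P_2+\sigma_2^2}{\sigma_1^2}$, $h_{23}^2\ge p^2\frac{P_2+\sigma_2^2}{\sigma_3^2}$, $h_{31}^2\ge\frac{P_3+\sigma_3^2}{\sigma_1^2}$, $h_{32}^2\ge q^2\frac{P_3+\sigma_3^2}{\sigma_2^2}$; (3) $h_{12}^2\ge\frac{P_1+\sigma_1^2}{\sigma_2^2}$, $h_{13}^2\ge q^2\frac{P_1+\sigma_1^2}{\sigma_3^2}$, $h_{21}^2\ge\frac{P_2+\sigma_2^2}{\sigma_1^2}$, $h_{23}^2\ge\frac{P_2+\sigma_2^2}{\sigma_3^2}$,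 $h_{31}^2\ge p^2\frac{P_3+\sigma_3^2}{\sigma_1^2}$, $h_{32}^2\ge\frac{P_3+\sigma_3^2}{\sigma_2^2}$. Then every triple $(R_1,R_2,R_3)$ with $0\le R_i\le\max\{0,\tfrac12\log_2(P_i/\sigma_i^2)\}$ for $i=1,2,3$ is achievable. In particular all users can simultaneously achieve rates within half a bit of their maximum possible rates: every achievable triple $(R_1,R_2,R_3)$ satisfies $R_i\le\max\{0,\tfrac12\log_2(P_i/\sigma_i^2)\}+\tfrac12$ for $i=1,2,3$. -/

import Mathlib

open MeasureTheory ProbabilityTheory Filter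

/-- The class of `3 × 3` real channel matrices with unit direct gains for which
`(h₁₂ / h₂₁) * (h₂₃ / h₃₂) * (h₃₁ / h₁₃)` is (well defined and) rational.
Users `1, 2, 3` are indexed by `0, 1, 2 : Fin 3`, and `H j k` is the gain from transmitter `k`
to receiver `j`. -/
def channelClass : Set (Matrix (Fin 3) (Fin 3) ℝ) :=
  {H | (∀ j, H j j = 1) ∧ H 1 0 ≠ 0 ∧ H 2 1 ≠ 0 ∧ H 0 2 ≠ 0 ∧
    ∃ r : ℚ, H 0 1 / H 1 0 * (H 1 2 / H 2 1) * (H 2 0 / H 0 2) = (r : ℝ)}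

/-- A block code of length `n` for the three-user interference channel under the average power
constraints `P`: user `k` has `M k` messages, each encoded as a real word of length `n` obeying
the power constraint, and receiver `j` estimates message `j` from its own received word. -/
structure ICCode (n : ℕ) (P : Fin 3 → ℝ) where
  M : Fin 3 → ℕ
  enc : ∀ k, Fin (M k) → Fin n → ℝ
  power_le : ∀ k m, (1 / (n : ℝ)) * ∑ i, enc k m i ^ 2 ≤ P k
  dec : ∀ j, (Fin n → ℝ) → Fin (M j)
  measurable_dec : ∀ j, Measurable (dec j)

/-- The law of `n` i.i.d. centred Gaussian noise samples with standard deviation `s`. -/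
noncomputable def noiseLaw (n : ℕ) (s : ℝ) : Measure (Fin n → ℝ) :=
  Measure.pi fun _ => gaussianReal 0 (s ^ 2).toNNReal

namespace ICCode

/-- The word received at receiver `j` when the messages `m` are sent and the noise is `z`. -/
def received {n : ℕ} {P : Fin 3 → ℝ} (C : ICCode n P) (H : Matrix (Fin 3) (Fin 3) ℝ)
    (m : ∀ k, Fin (C.M k)) (j : Fin 3) (z : Fin n → ℝ) : Fin n → ℝ :=
  fun i => ∑ k, H j k * C.enc k (m k) i + z i

/-- The probability that receiver `j` decodes its message wrongly, for independent uniformly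
distributed messages and noise of standard deviation `σ j` at receiver `j`. -/
noncomputable def errorProb {n : ℕ} {P : Fin 3 → ℝ} (C : ICCode n P)
    (H : Matrix (Fin 3) (Fin 3) ℝ) (σ : Fin 3 → ℝ) (j : Fin 3) : ℝ :=
  (∏ k, (C.M k : ℝ))⁻¹ * ∑ m : (∀ k, Fin (C.M k)),
    (noiseLaw n (σ j)).real {z | C.dec j (C.received H m j z) ≠ m j}

end ICCode

/-- Achievability in the Shannon sense: the rates (in bits per channel use) are nonnegative and,
for every backoff `δ > 0` and error level `ε > 0`, all sufficiently large block lengths admit a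
code with rates at least `R k - δ` and error probability at most `ε` at every receiver. -/
def Achievable (H : Matrix (Fin 3) (Fin 3) ℝ) (P σ R : Fin 3 → ℝ) : Prop :=
  (∀ k, 0 ≤ R k) ∧
  ∀ δ > 0, ∀ ε > 0, ∀ᶠ n : ℕ in atTop, ∃ C : ICCode n P,
    (∀ k, (2 : ℝ) ^ ((n : ℝ) * (R k - δ)) ≤ C.M k) ∧ ∀ j, C.errorProb H σ j ≤ ε

/-!
The direct part is a lattice argument in which the lattices are random parity-check codes lifted
to the integers. Rationality of the cross-gain ratio makes it possible to choose scales `a k` and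
`b j` such that, when user `k` sends words of `a k • ℤⁿ`, the interference at receiver `j` is `b j`
times an integer combination of the interferers' words (`IsAligned`). All users take their
parity checks modulo a prime `ℓ` of order `n` from one random family `T`, user `k` the first `m k`
of them, so the sets of checks are nested and the interference at each receiver satisfies all the
checks of one of its interferers. Receiver `j` recovers the interference first, treating its own
signal as noise of power `P j + σ j ^ 2`, subtracts it, and then decodes its own word in noise of
power `σ j ^ 2` (`eq_of_consistent`).

The two steps impose the same condition on `m k`: the strong-interference inequalities say that in
units of the respective grid the ball of radius `√(P j + σ j ^ 2)` at receiver `j` is no larger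
than that of radius `σ k` at receiver `k`. If `ℓ ^ m k` exceeds the volume of the latter by a small
exponential factor, then for every fixed noise vector ambiguity is unlikely over `T`
(`card_ambiguous_le`), whatever the distribution of the noise. User `k` keeps a fraction
`ℓ ^ (-m k)` of the lattice points in its power ball. Volumes of balls enter only through their
quotients, which gives the rate `log₂ (P k / σ k ^ 2) / 2`. The own signal depends on the code;
therefore errors are averaged first over `T` for each fixed word, and only then is the coset, that
is, the vector of prescribed parities, chosen for each user separately (`exists_good_fiber`,
`exists_code_of_checks`).

The converse bounds each user by its point-to-point capacity `log₂ (1 + P / σ ^ 2) / 2`. For fixed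
interfering words, a change of measure from the output law of a codeword to Gaussian noise of
variance `P + σ ^ 2` (`noiseLaw_change_of_measure`) and Chebyshev's inequality for the
log-likelihood ratio bound the number of messages (`exists_card_bound`).
-/

open scoped Pointwise Topology

/-! ### Balls and lattice points -/

/-- The closed Euclidean ball of radius `√n * r` about the origin of `ℝⁿ`: the words whose
root mean square is at most `r`. -/
def rmsBall (n : ℕ) (r : ℝ) : Set (Fin n → ℝ) := {x | ∑ i, x i ^ 2 ≤ n * r ^ 2}

theorem mem_rmsBall {n : ℕ} {r : ℝ} {x : Fin n → ℝ} :
    x ∈ rmsBall n r ↔ ∑ i, x i ^ 2 ≤ n * r ^ 2 := Iff.rfl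

theorem measurableSet_rmsBall (n : ℕ) (r : ℝ) : MeasurableSet (rmsBall n r) := by
  unfold rmsBall
  exact measurableSet_le (by fun_prop) measurable_const

theorem smul_mem_rmsBall {n : ℕ} {r c : ℝ} {x : Fin n → ℝ} (hx : x ∈ rmsBall n r) :
    c • x ∈ rmsBall n (c * r) := by
  rw [mem_rmsBall] at *
  simp only [Pi.smul_apply, smul_eq_mul, mul_pow, ← Finset.mul_sum]
  nlinarith [mul_le_mul_of_nonneg_left hx (sq_nonneg c)]

theorem neg_mem_rmsBall {n : ℕ} {r : ℝ} {x : Fin n → ℝ} (hx : x ∈ rmsBall n r) :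
    -x ∈ rmsBall n r := by
  simpa [mem_rmsBall] using hx

theorem rmsBall_mono {n : ℕ} {r s : ℝ} (hr : 0 ≤ r) (h : r ≤ s) : rmsBall n r ⊆ rmsBall n s := by
  intro x hx
  rw [mem_rmsBall] at *
  have : r ^ 2 ≤ s ^ 2 := by gcongr
  nlinarith [mul_le_mul_of_nonneg_left this (Nat.cast_nonneg (α := ℝ) n)]

theorem add_mem_rmsBall {n : ℕ} {r s : ℝ} (hr : 0 ≤ r) (hs : 0 ≤ s) {x y : Fin n → ℝ}
    (hx : x ∈ rmsBall n r) (hy : y ∈ rmsBall n s) : x + y ∈ rmsBall n (r + s) := by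
  have key : ∀ (t : ℝ), 0 ≤ t → ∀ v : Fin n → ℝ,
      v ∈ rmsBall n t ↔ ‖WithLp.toLp 2 v‖ ≤ √n * t := by
    intro t ht v
    rw [mem_rmsBall, ← abs_of_nonneg (norm_nonneg _),
      ← abs_of_nonneg (mul_nonneg (Real.sqrt_nonneg (n : ℝ)) ht), ← sq_le_sq,
      EuclideanSpace.norm_sq_eq, mul_pow, Real.sq_sqrt (Nat.cast_nonneg n)]
    simp
  rw [key _ hr] at hx
  rw [key _ hs] at hy
  rw [key _ (add_nonneg hr hs), WithLp.toLp_add]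
  linarith [norm_add_le (WithLp.toLp 2 x) (WithLp.toLp 2 y)]

theorem sub_mem_rmsBall {n : ℕ} {r s : ℝ} (hr : 0 ≤ r) (hs : 0 ≤ s) {x y : Fin n → ℝ}
    (hx : x ∈ rmsBall n r) (hy : y ∈ rmsBall n s) : x - y ∈ rmsBall n (r + s) := by
  rw [sub_eq_add_neg]
  exact add_mem_rmsBall hr hs hx (neg_mem_rmsBall hy)

theorem sq_coord_le_of_mem_rmsBall {n : ℕ} {r : ℝ} {x : Fin n → ℝ} (hx : x ∈ rmsBall n r)
    (i : Fin n) : x i ^ 2 ≤ n * r ^ 2 :=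
  (Finset.single_le_sum (f := fun i => x i ^ 2) (fun _ _ => sq_nonneg _)
    (Finset.mem_univ i)).trans hx

theorem rmsBall_subset_Icc (n : ℕ) (r : ℝ) :
    rmsBall n r ⊆ Set.Icc (fun _ => -(n * r ^ 2 + 1)) (fun _ => n * r ^ 2 + 1) := by
  intro x hx
  have h := fun i => sq_coord_le_of_mem_rmsBall hx i
  constructor <;> intro i <;> nlinarith [h i, sq_nonneg (x i + 1), sq_nonneg (x i - 1)]

theorem volume_rmsBall_ne_top (n : ℕ) (r : ℝ) : volume (rmsBall n r) ≠ ⊤ :=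
  ((measure_mono (rmsBall_subset_Icc n r)).trans_lt isCompact_Icc.measure_lt_top).ne

theorem volume_real_rmsBall {n : ℕ} {r : ℝ} (hr : 0 < r) :
    volume.real (rmsBall n r) = r ^ n * volume.real (rmsBall n 1) := by
  have h : rmsBall n r = r • rmsBall n 1 := by
    ext x
    rw [Set.mem_smul_set_iff_inv_smul_mem₀ hr.ne']
    constructor
    · intro hx
      have := smul_mem_rmsBall (c := r⁻¹) hx
      rwa [inv_mul_cancel₀ hr.ne'] at this
    · intro hx
      have := smul_mem_rmsBall (c := r) hx
      rwa [smul_inv_smul₀ hr.ne', mul_one] at this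
  rw [h, Measure.real, Measure.addHaar_smul_of_nonneg _ hr.le, ENNReal.toReal_mul,
    ENNReal.toReal_ofReal (by positivity), Module.finrank_fin_fun]
  rfl

/-- The vector of integers `u`, regarded as a real vector. -/
def realVec {n : ℕ} (u : Fin n → ℤ) : Fin n → ℝ := fun i => u i

@[simp] theorem realVec_apply {n : ℕ} (u : Fin n → ℤ) (i : Fin n) : realVec u i = u i := rfl

/-- The half-open unit cube centred at the integer point `u`. -/
def unitCube {n : ℕ} (u : Fin n → ℤ) : Set (Fin n → ℝ) :=
  Set.pi Set.univ fun i => Set.Ico ((u i : ℝ) - 1 / 2) (u i + 1 / 2)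

theorem volume_unitCube {n : ℕ} (u : Fin n → ℤ) : volume (unitCube u) = 1 := by
  unfold unitCube
  rw [Real.volume_pi_Ico]
  apply Finset.prod_eq_one
  intro i _
  norm_num [show (u i : ℝ) + 1 / 2 - (u i - 1 / 2) = 1 by ring]

theorem mem_unitCube_iff {n : ℕ} {u : Fin n → ℤ} {x : Fin n → ℝ} :
    x ∈ unitCube u ↔ u = fun i => ⌊x i + 1 / 2⌋ := by
  simp only [unitCube, Set.mem_pi, Set.mem_univ, true_implies, Set.mem_Ico, funext_iff]
  refine forall_congr' fun i => ?_
  rw [eq_comm, Int.floor_eq_iff]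
  constructor <;> rintro ⟨h1, h2⟩ <;> constructor <;> linarith

theorem sub_mem_rmsBall_of_mem_unitCube {n : ℕ} {u : Fin n → ℤ} {x : Fin n → ℝ}
    (hx : x ∈ unitCube u) : x - realVec u ∈ rmsBall n (1 / 2) := by
  rw [mem_rmsBall]
  have : ∀ i, (x - realVec u) i ^ 2 ≤ (1 / 2) ^ 2 := by
    intro i
    have := hx i (Set.mem_univ i)
    exact sq_le_sq' (by simp; linarith [this.1]) (by simp; linarith [this.2])
  calc _ ≤ ∑ _i : Fin n, ((1 : ℝ) / 2) ^ 2 := Finset.sum_le_sum fun i _ => this i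
    _ = _ := by simp

/-- The integer points within root mean square distance `r` of `w`. -/
def latticePoints {n : ℕ} (w : Fin n → ℝ) (r : ℝ) : Set (Fin n → ℤ) :=
  {u | w - realVec u ∈ rmsBall n r}

theorem latticePoints_finite {n : ℕ} (w : Fin n → ℝ) (r : ℝ) : (latticePoints w r).Finite := by
  refine (Set.finite_Icc (fun i => ⌊w i - (n * r ^ 2 + 1)⌋) fun i =>
    ⌈w i + (n * r ^ 2 + 1)⌉).subset fun u hu => ?_
  have h := rmsBall_subset_Icc n r hu
  constructor <;> intro i
  · have := h.2 i
    simp only [Pi.sub_apply, realVec_apply] at this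
    exact Int.floor_le_iff.2 (by linarith)
  · have := h.1 i
    simp only [Pi.sub_apply, realVec_apply] at this
    exact Int.le_ceil_iff.2 (by linarith)

/-- A ball contains at most as many integer points as the volume of the ball enlarged by half the
diagonal of a unit cube. -/
theorem card_le_volume_of_subset_latticePoints {n : ℕ} {w : Fin n → ℝ} {r : ℝ} (hr : 0 ≤ r)
    {F : Finset (Fin n → ℤ)} (hF : ∀ u ∈ F, u ∈ latticePoints w r) :
    (F.card : ℝ) ≤ volume.real (rmsBall n (r + 1 / 2)) := by
  have h1 : volume (⋃ u ∈ F, unitCube u) = F.card := by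
    rw [measure_biUnion_finset]
    · simp [volume_unitCube]
    · intro u _ v _ huv
      rw [Function.onFun, Set.disjoint_left]
      intro x hu hv
      exact huv ((mem_unitCube_iff.1 hu).trans (mem_unitCube_iff.1 hv).symm)
    · intro u _
      exact MeasurableSet.univ_pi fun i => measurableSet_Ico
  have h2 : (⋃ u ∈ F, unitCube u) ⊆ (fun x => w - x) ⁻¹' rmsBall n (r + 1 / 2) := by
    intro x hx
    simp only [Set.mem_iUnion] at hx
    obtain ⟨u, hu, hx⟩ := hx
    have := sub_mem_rmsBall hr (by norm_num) (hF u hu) (sub_mem_rmsBall_of_mem_unitCube hx)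
    rwa [sub_sub_sub_cancel_right] at this
  have h3 : volume ((fun x => w - x) ⁻¹' rmsBall n (r + 1 / 2)) =
      volume (rmsBall n (r + 1 / 2)) :=
    (Measure.measurePreserving_sub_left volume w).measure_preimage
      (measurableSet_rmsBall _ _).nullMeasurableSet
  have h4 : (F.card : ENNReal) ≤ volume (rmsBall n (r + 1 / 2)) := by
    rw [← h1, ← h3]
    exact measure_mono h2
  simpa [Measure.real] using ENNReal.toReal_mono (volume_rmsBall_ne_top _ _) h4

theorem volume_le_card_of_latticePoints_subset {n : ℕ} {r : ℝ} (hr : 0 ≤ r)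
    {F : Finset (Fin n → ℤ)} (hF : ∀ u : Fin n → ℤ, realVec u ∈ rmsBall n (r + 1 / 2) → u ∈ F) :
    volume.real (rmsBall n r) ≤ F.card := by
  have h : rmsBall n r ⊆ ⋃ u ∈ F, unitCube u := by
    intro x hx
    have hc : x ∈ unitCube fun i => ⌊x i + 1 / 2⌋ := mem_unitCube_iff.2 rfl
    refine Set.mem_biUnion (hF _ ?_) hc
    have := sub_mem_rmsBall hr (by norm_num) hx (sub_mem_rmsBall_of_mem_unitCube hc)
    simpa using this
  have h1 : volume (rmsBall n r) ≤ F.card := by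
    refine (measure_mono h).trans ((measure_biUnion_finset_le _ _).trans ?_)
    simp [volume_unitCube]
  simpa [Measure.real] using ENNReal.toReal_mono (by simp) h1

theorem one_le_volume_real_rmsBall {n : ℕ} {r : ℝ} (hr : 1 / 2 ≤ r) :
    1 ≤ volume.real (rmsBall n r) := by
  have := card_le_volume_of_subset_latticePoints (n := n) (w := 0) (r := r - 1 / 2)
    (by linarith) (F := {0}) (by
      intro u hu
      rw [Finset.mem_singleton] at hu
      subst hu
      simp [latticePoints, mem_rmsBall]
      positivity)
  simpa using this

/-! ### Random parity checks -/

/-- The value at the integer word `u` of the parity check with coefficients `c` modulo `ℓ`. -/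
def parity {n ℓ : ℕ} (c : Fin n → ZMod ℓ) (u : Fin n → ℤ) : ZMod ℓ := ∑ i, c i * (u i : ZMod ℓ)

theorem parity_sub {n ℓ : ℕ} (c : Fin n → ZMod ℓ) (u v : Fin n → ℤ) :
    parity c (u - v) = parity c u - parity c v := by
  simp [parity, mul_sub]

theorem parity_sum_mul {n ℓ : ℕ} {κ : Type*} (c : Fin n → ZMod ℓ) (S : Finset κ) (a : κ → ℤ)
    (u : κ → Fin n → ℤ) :
    parity c (∑ k ∈ S, a k • u k) = ∑ k ∈ S, (a k : ZMod ℓ) * parity c (u k) := by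
  simp only [parity, Finset.sum_apply, Pi.smul_apply, smul_eq_mul, Int.cast_sum, Int.cast_mul,
    Finset.mul_sum]
  rw [Finset.sum_comm]
  exact Finset.sum_congr rfl fun _ _ => Finset.sum_congr rfl fun _ _ => by ring

theorem card_parity_eq_zero {n ℓ : ℕ} [Fact ℓ.Prime] {u : Fin n → ℤ} {i₀ : Fin n}
    (hu : (u i₀ : ZMod ℓ) ≠ 0) :
    (Finset.univ.filter fun c : Fin n → ZMod ℓ => parity c u = 0).card * ℓ =
      Fintype.card (Fin n → ZMod ℓ) := by
  classical
  -- All values of the parity check are taken equally often, by translating along `i₀`.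
  have h : ∀ a : ZMod ℓ, (Finset.univ.filter fun c : Fin n → ZMod ℓ => parity c u = a).card =
      (Finset.univ.filter fun c : Fin n → ZMod ℓ => parity c u = 0).card := by
    intro a
    have hp : ∀ (c : Fin n → ZMod ℓ) (b : ZMod ℓ),
        parity (c + Pi.single i₀ b) u = parity c u + b * (u i₀ : ZMod ℓ) := by
      intro c b
      simp [parity, add_mul, Finset.sum_add_distrib, Pi.single_apply]
    refine Finset.card_bij' (fun c _ => c + Pi.single i₀ (-(a / u i₀)))
      (fun c _ => c + Pi.single i₀ (a / u i₀)) ?_ ?_ ?_ ?_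
    · intro c hc
      simp only [Finset.mem_filter, Finset.mem_univ, true_and] at hc ⊢
      rw [hp, hc]
      field_simp
      ring
    · intro c hc
      simp only [Finset.mem_filter, Finset.mem_univ, true_and] at hc ⊢
      rw [hp, hc]
      field_simp
      ring
    · intro c _
      simp [add_assoc, ← Pi.single_add]
    · intro c _
      simp [add_assoc, ← Pi.single_add]
  have := Finset.card_eq_sum_card_fiberwise (s := (Finset.univ : Finset (Fin n → ZMod ℓ)))
    (t := Finset.univ) (f := fun c => parity c u) (by simp)
  rw [Finset.card_univ] at this
  rw [this, Finset.sum_congr rfl fun a _ => h a, Finset.sum_const, Finset.card_univ, ZMod.card,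
    smul_eq_mul, mul_comm]

/-- If `u` does not vanish modulo `ℓ`, a uniformly random family of checks contains `u` in the
kernel of the checks indexed by `s` with probability `ℓ ^ (-|s|)`. -/
theorem card_checks_vanish {n ℓ : ℕ} [Fact ℓ.Prime] {ι : Type*} [Fintype ι] [DecidableEq ι]
    (s : Finset ι) {u : Fin n → ℤ} {i₀ : Fin n} (hu : (u i₀ : ZMod ℓ) ≠ 0) :
    (Finset.univ.filter fun T : ι → Fin n → ZMod ℓ => ∀ i ∈ s, parity (T i) u = 0).card *
      ℓ ^ s.card = Fintype.card (ι → Fin n → ZMod ℓ) := by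
  classical
  have h : (Finset.univ.filter fun T : ι → Fin n → ZMod ℓ => ∀ i ∈ s, parity (T i) u = 0) =
      Fintype.piFinset fun i => if i ∈ s then
        Finset.univ.filter (fun c : Fin n → ZMod ℓ => parity c u = 0) else Finset.univ := by
    ext T
    simp only [Finset.mem_filter, Finset.mem_univ, true_and, Fintype.mem_piFinset]
    refine forall_congr' fun i => ?_
    by_cases hi : i ∈ s <;> simp [hi]
  have h2 : ℓ ^ s.card = ∏ i : ι, if i ∈ s then ℓ else 1 := by
    rw [Finset.prod_ite_mem, Finset.univ_inter, Finset.prod_const]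
  rw [h, Fintype.card_piFinset, h2, ← Finset.prod_mul_distrib, Fintype.card_pi]
  refine Finset.prod_congr rfl fun i _ => ?_
  by_cases hi : i ∈ s
  · simpa [hi] using card_parity_eq_zero hu
  · simp [hi]

/-- The word `w` is ambiguous at scale `b` and radius `r` for the checks `T i`, `i ∈ s`: it lies
in the ball of radius `r`, and remains there after subtraction of `b` times a nonzero integer word
which satisfies these checks. -/
def Ambiguous {n ℓ : ℕ} {ι : Type*} (T : ι → Fin n → ZMod ℓ) (s : Finset ι) (b r : ℝ)
    (w : Fin n → ℝ) : Prop :=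
  w ∈ rmsBall n r ∧ ∃ u : Fin n → ℤ, u ≠ 0 ∧ (∀ i ∈ s, parity (T i) u = 0) ∧
    w - b • realVec u ∈ rmsBall n r

theorem measurableSet_ambiguous {n ℓ : ℕ} {ι : Type*} (T : ι → Fin n → ZMod ℓ) (s : Finset ι)
    (b r : ℝ) : MeasurableSet {w | Ambiguous T s b r w} := by
  have : {w | Ambiguous T s b r w} = rmsBall n r ∩ ⋃ u : {u : Fin n → ℤ // u ≠ 0 ∧
      ∀ i ∈ s, parity (T i) u = 0}, (fun w => w - b • realVec u.1) ⁻¹' rmsBall n r := by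
    ext w
    simp [Ambiguous, and_assoc]
  rw [this]
  exact (measurableSet_rmsBall n r).inter (MeasurableSet.iUnion fun u =>
    (measurableSet_rmsBall n r).preimage (by fun_prop))

/-- For any fixed word, the probability over the checks that it is ambiguous is at most the number
of lattice points in a ball divided by `ℓ ^ |s|`. The prime `ℓ` must be so large that the integer
words which can cause ambiguity do not vanish modulo `ℓ`. -/
theorem card_ambiguous_le {n ℓ : ℕ} [Fact ℓ.Prime] {ι : Type*} [Fintype ι] [DecidableEq ι]
    (s : Finset ι) {b r : ℝ} (hb : b ≠ 0) (hr : 0 ≤ r)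
    (hℓ : n * (2 * r / |b|) ^ 2 < (ℓ : ℝ) ^ 2) (w : Fin n → ℝ)
    [DecidablePred fun T : ι → Fin n → ZMod ℓ => Ambiguous T s b r w] :
    ((Finset.univ.filter fun T : ι → Fin n → ZMod ℓ => Ambiguous T s b r w).card : ℝ) *
      (ℓ : ℝ) ^ s.card ≤
    volume.real (rmsBall n (r / |b| + 1 / 2)) * Fintype.card (ι → Fin n → ZMod ℓ) := by
  classical
  have hb' : 0 < |b| := abs_pos.2 hb
  have hnorm : ∀ {t : ℝ} {x : Fin n → ℝ}, x ∈ rmsBall n t → b⁻¹ • x ∈ rmsBall n (t / |b|) := by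
    intro t x hx
    have := smul_mem_rmsBall (c := b⁻¹) hx
    rw [mem_rmsBall] at this ⊢
    rwa [div_pow, sq_abs, ← div_pow, div_eq_inv_mul]
  by_cases hw : w ∈ rmsBall n r
  swap
  · rw [Finset.filter_false_of_mem (by intro T _ h; exact hw h.1)]
    simp only [Finset.card_empty, Nat.cast_zero, zero_mul]
    positivity
  set F : Finset (Fin n → ℤ) :=
    (latticePoints_finite (b⁻¹ • w) (r / |b|)).toFinset.filter (· ≠ 0) with hF
  have hFmem : ∀ u : Fin n → ℤ, w - b • realVec u ∈ rmsBall n r →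
      b⁻¹ • w - realVec u ∈ rmsBall n (r / |b|) := by
    intro u hu
    have := hnorm hu
    rwa [smul_sub, inv_smul_smul₀ hb] at this
  have hsub : (Finset.univ.filter fun T : ι → Fin n → ZMod ℓ => Ambiguous T s b r w) ⊆
      F.biUnion fun u => Finset.univ.filter fun T : ι → Fin n → ZMod ℓ =>
        ∀ i ∈ s, parity (T i) u = 0 := by
    intro T hT
    obtain ⟨-, u, hu0, hus, hu⟩ := (Finset.mem_filter.1 hT).2
    simp only [Finset.mem_biUnion, Finset.mem_filter, Finset.mem_univ, true_and, hF,
      Set.Finite.mem_toFinset]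
    exact ⟨u, ⟨hFmem u hu, hu0⟩, hus⟩
  have hFcard : (F.card : ℝ) ≤ volume.real (rmsBall n (r / |b| + 1 / 2)) :=
    card_le_volume_of_subset_latticePoints (w := b⁻¹ • w) (by positivity) (by
      intro u hu
      simpa using (Finset.mem_filter.1 hu).1)
  have hFu : ∀ u ∈ F, (Finset.univ.filter fun T : ι → Fin n → ZMod ℓ =>
      ∀ i ∈ s, parity (T i) u = 0).card * ℓ ^ s.card = Fintype.card (ι → Fin n → ZMod ℓ) := by
    intro u hu
    rw [hF, Finset.mem_filter, Set.Finite.mem_toFinset] at hu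
    obtain ⟨i₀, hi₀⟩ := Function.ne_iff.1 hu.2
    refine card_checks_vanish s (i₀ := i₀) fun h0 => hi₀ ?_
    rw [ZMod.intCast_zmod_eq_zero_iff_dvd] at h0
    have h1 : realVec u ∈ rmsBall n (r / |b| + r / |b|) := by
      have := sub_mem_rmsBall (by positivity) (by positivity) (hnorm hw) hu.1
      simpa using this
    have h2 := sq_coord_le_of_mem_rmsBall h1 i₀
    have h3 : (u i₀ : ℝ) ^ 2 < (ℓ : ℝ) ^ 2 := by
      refine lt_of_le_of_lt h2 ?_
      rwa [show r / |b| + r / |b| = 2 * r / |b| by ring]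
    have h4 : u i₀ ^ 2 < (ℓ : ℤ) ^ 2 := by exact_mod_cast h3
    exact Int.eq_zero_of_abs_lt_dvd h0 (by
      have := sq_lt_sq.1 h4
      simpa using this)
  have hnat : (Finset.univ.filter fun T : ι → Fin n → ZMod ℓ => Ambiguous T s b r w).card *
      ℓ ^ s.card ≤ F.card * Fintype.card (ι → Fin n → ZMod ℓ) := by
    calc _ ≤ (∑ u ∈ F, (Finset.univ.filter fun T : ι → Fin n → ZMod ℓ =>
          ∀ i ∈ s, parity (T i) u = 0).card) * ℓ ^ s.card :=
          Nat.mul_le_mul_right _ ((Finset.card_le_card hsub).trans Finset.card_biUnion_le)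
      _ = F.card * Fintype.card (ι → Fin n → ZMod ℓ) := by
          rw [Finset.sum_mul, Finset.sum_congr rfl hFu, Finset.sum_const, smul_eq_mul]
  calc _ ≤ (F.card : ℝ) * Fintype.card (ι → Fin n → ZMod ℓ) := by exact_mod_cast hnat
    _ ≤ _ := by gcongr

/-! ### First-moment arguments -/

/-- Among the fibres of a hash function on `G`, one has at least half the average size and an
average error at most twice that over `G`. -/
theorem exists_good_fiber {V τ : Type*} [Fintype τ] [DecidableEq τ] {G : Finset V}
    (hG : G.Nonempty) (h : V → τ) {e : V → ℝ} {ε : ℝ} (hε : 0 < ε)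
    (he : ∑ v ∈ G, e v ≤ ε * G.card) (he0 : ∀ v, 0 ≤ e v) :
    ∃ t, (G.card : ℝ) / (2 * Fintype.card τ) ≤ (G.filter fun v => h v = t).card ∧
      ∑ v ∈ G.filter (fun v => h v = t), e v ≤ 2 * ε * (G.filter fun v => h v = t).card := by
  have hτ : Nonempty τ := ⟨h hG.choose⟩
  have hc : 0 < (Fintype.card τ : ℝ) := by exact_mod_cast Fintype.card_pos
  have hsum : ∑ t : τ, ((G.filter fun v => h v = t).card -
      (∑ v ∈ G.filter (fun v => h v = t), e v) / (2 * ε) : ℝ) =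
      G.card - (∑ v ∈ G, e v) / (2 * ε) := by
    rw [Finset.sum_sub_distrib, ← Finset.sum_div, Finset.sum_fiberwise, ← Nat.cast_sum,
      ← Finset.card_eq_sum_card_fiberwise (by simp)]
  have hle : ∑ _t : τ, (G.card : ℝ) / (2 * Fintype.card τ) ≤
      ∑ t : τ, ((G.filter fun v => h v = t).card -
        (∑ v ∈ G.filter (fun v => h v = t), e v) / (2 * ε) : ℝ) := by
    rw [hsum, Finset.sum_const, Finset.card_univ, nsmul_eq_mul]
    have h1 : (Fintype.card τ : ℝ) * (G.card / (2 * Fintype.card τ)) = G.card / 2 := by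
      field_simp
    have h2 : (∑ v ∈ G, e v) / (2 * ε) ≤ G.card / 2 := by
      rw [div_le_iff₀ (by positivity)]
      linarith
    linarith
  obtain ⟨t, -, ht⟩ := Finset.exists_le_of_sum_le Finset.univ_nonempty hle
  have h0 : 0 ≤ ∑ v ∈ G.filter (fun v => h v = t), e v := Finset.sum_nonneg fun v _ => he0 v
  have h1 : 0 ≤ (G.card : ℝ) / (2 * Fintype.card τ) := by positivity
  have h2 : 0 ≤ (∑ v ∈ G.filter (fun v => h v = t), e v) / (2 * ε) := by positivity
  refine ⟨t, by linarith, ?_⟩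
  have h3 : (∑ v ∈ G.filter (fun v => h v = t), e v) / (2 * ε) ≤
      (G.filter fun v => h v = t).card := by linarith
  rw [div_le_iff₀ (by positivity)] at h3
  linarith

/-- If every outcome lies in at most a fraction `B` of the sets `A T`, then these sets have
average probability at most `B`. -/
theorem sum_measureReal_le_of_card_le {Ω κ : Type*} [MeasurableSpace Ω] [Fintype κ]
    (μ : Measure Ω) [IsProbabilityMeasure μ] {A : κ → Set Ω} (hA : ∀ T, MeasurableSet (A T))
    {B : ℝ} (hB : ∀ z, (∑ T, (A T).indicator (fun _ => (1 : ℝ)) z) ≤ B) :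
    ∑ T, μ.real (A T) ≤ B := by
  have hint : ∀ T, Integrable ((A T).indicator fun _ => (1 : ℝ)) μ :=
    fun T => (integrable_const 1).indicator (hA T)
  calc ∑ T, μ.real (A T) = ∑ T, ∫ z, (A T).indicator (fun _ => (1 : ℝ)) z ∂μ := by
        refine Finset.sum_congr rfl fun T _ => ?_
        rw [integral_indicator (hA T)]
        simp
    _ = ∫ z, ∑ T, (A T).indicator (fun _ => (1 : ℝ)) z ∂μ :=
        (integral_finsetSum _ fun T _ => hint T).symm
    _ ≤ ∫ _z, B ∂μ := integral_mono (integrable_finsetSum _ fun T _ => hint T)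
        (integrable_const B) hB
    _ = B := by simp

/-! ### Concentration of the Gaussian noise -/

instance isProbabilityMeasure_noiseLaw (n : ℕ) (s : ℝ) : IsProbabilityMeasure (noiseLaw n s) := by
  unfold noiseLaw
  infer_instance

theorem memLp_gaussianReal_sq (s : ℝ) :
    MemLp (fun z : ℝ => z ^ 2) 2 (gaussianReal 0 (s ^ 2).toNNReal) := by
  rw [memLp_two_iff_integrable_sq (by fun_prop)]
  have h := (memLp_id_gaussianReal' (μ := 0) (v := (s ^ 2).toNNReal) 4 (by simp)).integrable_norm_pow
    (p := 4) (by norm_num)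
  refine h.congr (ae_of_all _ fun z => ?_)
  simp only [id, Real.norm_eq_abs]
  rw [show |z| ^ 4 = (|z| ^ 2) ^ 2 by ring, sq_abs]

theorem integral_gaussianReal_id (s : ℝ) :
    ∫ z, z ∂gaussianReal 0 (s ^ 2).toNNReal = 0 := by simp

theorem integral_gaussianReal_sq (s : ℝ) :
    ∫ z, z ^ 2 ∂gaussianReal 0 (s ^ 2).toNNReal = s ^ 2 := by
  have h := variance_fun_id_gaussianReal (μ := 0) (v := (s ^ 2).toNNReal)
  rw [variance_of_integral_eq_zero (by fun_prop) (by simp)] at h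
  rw [h, Real.coe_toNNReal _ (sq_nonneg s)]

theorem memLp_gaussianReal_quadratic (s a c : ℝ) :
    MemLp (fun z : ℝ => a * z ^ 2 + c * z) 2 (gaussianReal 0 (s ^ 2).toNNReal) :=
  ((memLp_gaussianReal_sq s).const_mul a).add ((memLp_id_gaussianReal' 2 (by simp)).const_mul c)

theorem integral_gaussianReal_quadratic (s a c : ℝ) :
    ∫ z, (a * z ^ 2 + c * z) ∂gaussianReal 0 (s ^ 2).toNNReal = a * s ^ 2 := by
  have h1 := (memLp_gaussianReal_sq s).integrable one_le_two
  have h0 : Integrable (fun z : ℝ => z) (gaussianReal 0 (s ^ 2).toNNReal) :=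
    (memLp_id_gaussianReal' 2 (by simp)).integrable one_le_two
  rw [integral_add (h1.const_mul a) (h0.const_mul c), integral_const_mul,
    integral_const_mul, integral_gaussianReal_sq, integral_gaussianReal_id]
  ring

theorem variance_gaussianReal_quadratic_le (s a c : ℝ) :
    Var[fun z : ℝ => a * z ^ 2 + c * z; gaussianReal 0 (s ^ 2).toNNReal] ≤
      2 * a ^ 2 * (∫ z, (z ^ 2) ^ 2 ∂gaussianReal 0 (s ^ 2).toNNReal) + 2 * s ^ 2 * c ^ 2 := by
  have h1 := (memLp_gaussianReal_sq s).integrable one_le_two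
  have h2 := (memLp_gaussianReal_sq s).integrable_sq
  calc _ ≤ ∫ z, ((fun z : ℝ => a * z ^ 2 + c * z) ^ 2) z ∂gaussianReal 0 (s ^ 2).toNNReal :=
        variance_le_expectation_sq (memLp_gaussianReal_quadratic s a c).aestronglyMeasurable
    _ ≤ ∫ z, (2 * a ^ 2 * (z ^ 2) ^ 2 + 2 * c ^ 2 * z ^ 2) ∂gaussianReal 0 (s ^ 2).toNNReal := by
        refine integral_mono (memLp_gaussianReal_quadratic s a c).integrable_sq
          ((h2.const_mul _).add (h1.const_mul _)) fun z => ?_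
        simp only [Pi.pow_apply]
        nlinarith [sq_nonneg (a * z ^ 2 - c * z)]
    _ = _ := by
        rw [integral_add (h2.const_mul _) (h1.const_mul _), integral_const_mul,
          integral_const_mul, integral_gaussianReal_sq]
        ring

/-- Chebyshev's inequality for a sum of functions of the individual noise samples. -/
theorem noiseLaw_chebyshev {n : ℕ} (s : ℝ) {f : Fin n → ℝ → ℝ}
    (hf : ∀ i, MemLp (f i) 2 (gaussianReal 0 (s ^ 2).toNNReal)) {m v c : ℝ} (hc : 0 < c)
    (hm : ∑ i, ∫ z, f i z ∂gaussianReal 0 (s ^ 2).toNNReal = m)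
    (hv : ∑ i, Var[f i; gaussianReal 0 (s ^ 2).toNNReal] ≤ v) :
    (noiseLaw n s).real {z | m + c ≤ ∑ i, f i (z i)} ≤ v / c ^ 2 := by
  set g := gaussianReal 0 (s ^ 2).toNNReal with hg
  set Y : (Fin n → ℝ) → ℝ := ∑ i : Fin n, fun z : Fin n → ℝ => f i (z i) with hY
  have hLp : ∀ i : Fin n, MemLp (fun z : Fin n → ℝ => f i (z i)) 2 (noiseLaw n s) := fun i =>
    (hf i).comp_measurePreserving (measurePreserving_eval (fun _ : Fin n => g) i)
  have hYLp : MemLp Y 2 (noiseLaw n s) := memLp_finsetSum' _ fun i _ => hLp i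
  have hYvar : Var[Y; noiseLaw n s] ≤ v :=
    (variance_sum_pi (μ := fun _ : Fin n => g) hf).trans_le hv
  have hYint : ∫ z, Y z ∂noiseLaw n s = m := by
    simp only [hY, Finset.sum_apply]
    rw [integral_finsetSum _ fun i _ => (hLp i).integrable one_le_two, ← hm]
    exact Finset.sum_congr rfl fun i _ => integral_comp_eval (μ := fun _ : Fin n => g) (i := i)
        (f := f i) (hf i).aestronglyMeasurable
  have hcheb := meas_ge_le_variance_div_sq hYLp hc
  rw [hYint] at hcheb
  calc _ ≤ (noiseLaw n s).real {z | c ≤ |Y z - m|} := by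
        refine measureReal_mono fun z hz => ?_
        simp only [Set.mem_ofPred_eq] at hz ⊢
        refine le_trans ?_ (le_abs_self _)
        simp only [hY, Finset.sum_apply]
        linarith
    _ ≤ Var[Y; noiseLaw n s] / c ^ 2 := by
        rw [Measure.real]
        exact ENNReal.toReal_le_of_le_ofReal
          (div_nonneg (variance_nonneg _ _) (sq_nonneg _)) hcheb
    _ ≤ v / c ^ 2 := by gcongr

/-- Concentration of a sum of quadratic polynomials in the noise samples. The constant depends on
the noise level only. -/
theorem exists_noise_concentration (s : ℝ) : ∃ K : ℝ, 0 ≤ K ∧ ∀ (n : ℕ) (α A t : ℝ) (γ : Fin n → ℝ),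
    0 < n → 0 < t → ∑ i, γ i ^ 2 ≤ n * A →
    (noiseLaw n s).real {z | n * (α * s ^ 2 + t) ≤ ∑ i, (α * z i ^ 2 + γ i * z i)} ≤
      K * (α ^ 2 + A) / (n * t ^ 2) := by
  obtain ⟨k, hk⟩ : ∃ k, k = ∫ z, (z ^ 2) ^ 2 ∂gaussianReal 0 (s ^ 2).toNNReal := ⟨_, rfl⟩
  have hk0 : 0 ≤ k := hk ▸ integral_nonneg fun z => by positivity
  refine ⟨2 * k + 2 * s ^ 2, by positivity, fun n α A t γ hn ht hγ => ?_⟩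
  have hn' : (0 : ℝ) < n := by exact_mod_cast hn
  have hA : 0 ≤ A := by
    have : 0 ≤ n * A := (Finset.sum_nonneg fun i _ => sq_nonneg (γ i)).trans hγ
    exact nonneg_of_mul_nonneg_right this hn'
  have hv : ∑ i, Var[fun z : ℝ => α * z ^ 2 + γ i * z; gaussianReal 0 (s ^ 2).toNNReal] ≤
      (2 * k + 2 * s ^ 2) * (α ^ 2 + A) * n := by
    calc _ ≤ ∑ i : Fin n, (2 * α ^ 2 * k + 2 * s ^ 2 * γ i ^ 2) :=
          Finset.sum_le_sum fun i _ => hk ▸ variance_gaussianReal_quadratic_le s α (γ i)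
      _ = n * (2 * α ^ 2 * k) + 2 * s ^ 2 * ∑ i, γ i ^ 2 := by
          rw [Finset.sum_add_distrib, Finset.mul_sum]
          simp
      _ ≤ n * (2 * α ^ 2 * k) + 2 * s ^ 2 * (n * A) := by gcongr
      _ ≤ _ := by
          have h1 : 0 ≤ k * A * n := by positivity
          have h2 : 0 ≤ s ^ 2 * α ^ 2 * n := by positivity
          linarith
  have h := noiseLaw_chebyshev (n := n) s (fun i => memLp_gaussianReal_quadratic s α (γ i))
    (m := n * (α * s ^ 2)) (c := n * t) (by positivity)
    (by simp [integral_gaussianReal_quadratic]) hv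
  rw [← mul_add] at h
  refine h.trans_eq ?_
  field_simp

/-- A word of power at most `P` plus noise of level `s` stays, with high probability, within any
radius greater than `√(P + s²)`. -/
theorem exists_noise_ball_bound (s P θ : ℝ) (hP : 0 ≤ P) (hs : 0 < s) (hθ : 0 < θ) : ∃ K : ℝ,
    0 ≤ K ∧ ∀ (n : ℕ) (x : Fin n → ℝ), 0 < n → ∑ i, x i ^ 2 ≤ n * P →
    (noiseLaw n s).real {z | x + z ∉ rmsBall n √((P + s ^ 2) * (1 + θ))} ≤ K / n := by
  obtain ⟨K, hK, h⟩ := exists_noise_concentration s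
  set t := (P + s ^ 2) * θ with ht
  have htpos : 0 < t := by positivity
  refine ⟨K * (1 ^ 2 + 4 * P) / t ^ 2, by positivity, fun n x hn hx => ?_⟩
  have := h n 1 (4 * P) t (fun i => 2 * x i) hn htpos (by
    simp only [mul_pow, ← Finset.mul_sum]
    linarith)
  refine (measureReal_mono fun z hz => ?_).trans (this.trans_eq (by field_simp))
  simp only [Set.mem_ofPred_eq, mem_rmsBall, not_le] at hz ⊢
  rw [Real.sq_sqrt (by positivity)] at hz
  have h1 : ∑ i, (x + z) i ^ 2 = ∑ i, x i ^ 2 + ∑ i, (1 * z i ^ 2 + 2 * x i * z i) := by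
    rw [← Finset.sum_add_distrib]
    exact Finset.sum_congr rfl fun i _ => by simp only [Pi.add_apply]; ring
  rw [h1] at hz
  have h2 : (n : ℝ) * ((P + s ^ 2) * (1 + θ)) = n * P + n * (s ^ 2 + t) := by rw [ht]; ring
  rw [h2] at hz
  linarith

/-! ### The single-user upper bound -/

theorem pi_gaussianReal_eq_withDensity {n : ℕ} (x : Fin n → ℝ) {v : NNReal} (hv : v ≠ 0) :
    Measure.pi (fun i => gaussianReal (x i) v) =
      volume.withDensity fun y => ENNReal.ofReal (∏ i, gaussianPDFReal (x i) v (y i)) := by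
  refine Measure.pi_eq fun S hS => ?_
  have hr : ∀ i, Integrable (gaussianPDFReal (x i) v) (volume.restrict (S i)) :=
    fun i => (integrable_gaussianPDFReal _ _).restrict
  rw [withDensity_apply _ (MeasurableSet.univ_pi hS), volume_pi, Measure.restrict_pi_pi,
    ← ofReal_integral_eq_lintegral_ofReal (Integrable.fintype_prod_dep hr)
      (ae_of_all _ fun y => Finset.prod_nonneg fun i _ => gaussianPDFReal_nonneg _ _ _),
    integral_fintype_prod_eq_prod, ENNReal.ofReal_prod_of_nonneg
      fun i _ => integral_nonneg fun y => gaussianPDFReal_nonneg _ _ _]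
  refine Finset.prod_congr rfl fun i _ => ?_
  rw [ofReal_integral_eq_lintegral_ofReal (hr i)
    (ae_of_all _ fun y => gaussianPDFReal_nonneg _ _ _), gaussianReal_apply _ hv]
  rfl

theorem measurePreserving_add_noiseLaw {n : ℕ} (x : Fin n → ℝ) (s : ℝ) :
    MeasurePreserving (fun z => x + z) (noiseLaw n s)
      (Measure.pi fun i => gaussianReal (x i) (s ^ 2).toNNReal) := by
  refine measurePreserving_pi (fun _ => gaussianReal 0 (s ^ 2).toNNReal) _
    (f := fun i z => x i + z) fun i => ⟨by fun_prop, ?_⟩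
  rw [gaussianReal_map_const_add, zero_add]

/-- Change of measure from the law of `x` plus noise of level `s` to centred noise of level `τ`,
where the set on which the likelihood ratio exceeds `c` is split off. -/
theorem noiseLaw_change_of_measure {n : ℕ} {s τ : ℝ} (hs : 0 < s) (hτ : 0 < τ) (x : Fin n → ℝ)
    {D : Set (Fin n → ℝ)} (hD : MeasurableSet D) {c : ℝ} (hc : 0 ≤ c) :
    (noiseLaw n s).real {z | x + z ∈ D} ≤ c * (noiseLaw n τ).real D +
      (noiseLaw n s).real {z | c * ∏ i, gaussianPDFReal 0 (τ ^ 2).toNNReal (x i + z i) <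
        ∏ i, gaussianPDFReal 0 (s ^ 2).toNNReal (z i)} := by
  have hpos : ∀ {r : ℝ}, 0 < r → (r ^ 2).toNNReal ≠ 0 := fun hr => by
    simpa using hr.ne'
  set f : (Fin n → ℝ) → ℝ := fun y => ∏ i, gaussianPDFReal (x i) (s ^ 2).toNNReal (y i) with hf
  set g : (Fin n → ℝ) → ℝ := fun y => ∏ i, gaussianPDFReal 0 (τ ^ 2).toNNReal (y i) with hg
  have hfm : Measurable f := Finset.measurable_fun_prod _ fun i _ =>
    (measurable_gaussianPDFReal _ _).comp (measurable_pi_apply i)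
  have hgm : Measurable g := Finset.measurable_fun_prod _ fun i _ =>
    (measurable_gaussianPDFReal _ _).comp (measurable_pi_apply i)
  have hA : MeasurableSet (D ∩ {y | f y ≤ c * g y}) :=
    hD.inter (measurableSet_le hfm (hgm.const_mul c))
  have hsub : {z | x + z ∈ D} ⊆ (fun z => x + z) ⁻¹' (D ∩ {y | f y ≤ c * g y}) ∪
      {z | c * ∏ i, gaussianPDFReal 0 (τ ^ 2).toNNReal (x i + z i) <
        ∏ i, gaussianPDFReal 0 (s ^ 2).toNNReal (z i)} := by
    intro z hz
    by_cases h : f (x + z) ≤ c * g (x + z)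
    · exact Or.inl ⟨hz, h⟩
    · right
      simpa [hf, hg, gaussianPDFReal] using h
  refine (measureReal_mono hsub).trans ((measureReal_union_le _ _).trans ?_)
  gcongr
  rw [(measurePreserving_add_noiseLaw x s).measureReal_preimage hA.nullMeasurableSet]
  have h1 : (Measure.pi fun i => gaussianReal (x i) (s ^ 2).toNNReal) (D ∩ {y | f y ≤ c * g y}) ≤
      ENNReal.ofReal c * noiseLaw n τ D := by
    rw [noiseLaw, pi_gaussianReal_eq_withDensity x (hpos hs),
      pi_gaussianReal_eq_withDensity (fun _ => 0) (hpos hτ), withDensity_apply _ hA,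
      withDensity_apply _ hD, ← lintegral_const_mul _ (by fun_prop)]
    calc _ ≤ ∫⁻ y in D ∩ {y | f y ≤ c * g y}, ENNReal.ofReal c * ENNReal.ofReal (g y) := by
          refine setLIntegral_mono (by fun_prop) fun y hy => ?_
          rw [← ENNReal.ofReal_mul hc]
          exact ENNReal.ofReal_le_ofReal hy.2
      _ ≤ _ := lintegral_mono_set Set.inter_subset_left
  have h2 := ENNReal.toReal_mono (ENNReal.mul_ne_top ENNReal.ofReal_ne_top (measure_ne_top _ _)) h1
  rwa [ENNReal.toReal_mul, ENNReal.toReal_ofReal hc] at h2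

theorem prod_gaussianPDFReal_zero {n : ℕ} {s : ℝ} (hs : 0 < s) (y : Fin n → ℝ) :
    ∏ i, gaussianPDFReal 0 (s ^ 2).toNNReal (y i) =
      (√(2 * Real.pi) * s)⁻¹ ^ n * Real.exp (-((∑ i, y i ^ 2) / (2 * s ^ 2))) := by
  simp only [gaussianPDFReal, sub_zero, Real.coe_toNNReal _ (sq_nonneg s)]
  rw [Finset.prod_mul_distrib, ← Real.exp_sum, Finset.prod_const, Finset.card_univ,
    Fintype.card_fin, Real.sqrt_mul (by positivity), Real.sqrt_sq hs.le]
  congr 2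
  rw [Finset.sum_div, ← Finset.sum_neg_distrib]
  exact Finset.sum_congr rfl fun i _ => by ring

/-- The log-likelihood ratio of `x` plus noise against centred noise of variance `P + s²` exceeds
its maximal mean `n * log (τ / s)` linearly in `n` only with vanishing probability. -/
theorem exists_likelihood_bound {s P t : ℝ} (hs : 0 < s) (hP : 0 ≤ P) (ht : 0 < t) : ∃ K : ℝ,
    0 ≤ K ∧ ∀ (n : ℕ) (x : Fin n → ℝ), 0 < n → ∑ i, x i ^ 2 ≤ n * P →
    (noiseLaw n s).real {z | (√(P + s ^ 2) / s) ^ n * Real.exp (n * t) *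
      ∏ i, gaussianPDFReal 0 (√(P + s ^ 2) ^ 2).toNNReal (x i + z i) <
        ∏ i, gaussianPDFReal 0 (s ^ 2).toNNReal (z i)} ≤ K / n := by
  obtain ⟨K, hK, h⟩ := exists_noise_concentration s
  set w := P + s ^ 2 with hw
  have hwpos : 0 < w := by positivity
  set τ := √w with hτdef
  have hτ : 0 < τ := Real.sqrt_pos.2 hwpos
  have hτsq : τ ^ 2 = w := Real.sq_sqrt hwpos.le
  set α := 1 / (2 * w) - 1 / (2 * s ^ 2) with hα
  refine ⟨K * (α ^ 2 + P / w ^ 2) / t ^ 2, by positivity, fun n x hn hx => ?_⟩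
  have := h n α (P / w ^ 2) t (fun i => x i / w) hn ht (by
    simp only [div_pow, ← Finset.sum_div]
    rw [← mul_div_assoc]
    gcongr)
  refine (measureReal_mono fun z hz => ?_).trans (this.trans_eq (by field_simp))
  simp only [Set.mem_ofPred_eq] at hz ⊢
  rw [prod_gaussianPDFReal_zero hτ (fun i => x i + z i), prod_gaussianPDFReal_zero hs] at hz
  have h1 : (τ / s) ^ n * Real.exp (n * t) * ((√(2 * Real.pi) * τ)⁻¹ ^ n *
      Real.exp (-((∑ i, (x i + z i) ^ 2) / (2 * τ ^ 2)))) =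
      (√(2 * Real.pi) * s)⁻¹ ^ n *
        Real.exp (n * t + -((∑ i, (x i + z i) ^ 2) / (2 * τ ^ 2))) := by
    have : (√(2 * Real.pi) * s)⁻¹ = τ / s * (√(2 * Real.pi) * τ)⁻¹ := by field_simp
    rw [this, mul_pow, Real.exp_add]
    ring
  rw [h1, mul_lt_mul_iff_right₀ (by positivity), Real.exp_lt_exp, hτsq] at hz
  have h2 : ∑ i, (x i + z i) ^ 2 = ∑ i, x i ^ 2 + (2 * ∑ i, x i * z i + ∑ i, z i ^ 2) := by
    rw [Finset.mul_sum, ← Finset.sum_add_distrib, ← Finset.sum_add_distrib]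
    exact Finset.sum_congr rfl fun i _ => by ring
  have h3 : ∑ i, (α * z i ^ 2 + x i / w * z i) =
      α * ∑ i, z i ^ 2 + (∑ i, x i * z i) / w := by
    rw [Finset.sum_add_distrib, Finset.mul_sum, Finset.sum_div]
    congr 1
    exact Finset.sum_congr rfl fun i _ => by ring
  have h4 : α * s ^ 2 = -(P / (2 * w)) := by
    rw [hα]
    field_simp
    rw [hw]
    ring
  have h5 : (∑ i, x i ^ 2) / (2 * w) ≤ n * (P / (2 * w)) := by
    rw [← mul_div_assoc]
    gcongr
  have h6 : (∑ i, (x i + z i) ^ 2) / (2 * w) = (∑ i, x i ^ 2) / (2 * w) + (∑ i, x i * z i) / w +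
      (∑ i, z i ^ 2) / (2 * w) := by
    rw [h2]
    field_simp
    ring
  have h7 : α * ∑ i, z i ^ 2 = (∑ i, z i ^ 2) / (2 * w) - (∑ i, z i ^ 2) / (2 * s ^ 2) := by
    rw [hα]
    ring
  rw [h3, h4, h7]
  linarith

/-- Summing over the message of user `j` once more counts every message tuple `M j` times. -/
theorem sum_pi_eq_sum_update {M : Fin 3 → ℕ} (j : Fin 3) (f : (∀ k, Fin (M k)) → ℝ) :
    (M j : ℝ) * ∑ m, f m = ∑ m, ∑ a, f (Function.update m j a) := by
  classical
  have h : ∀ g : (∀ k, Fin (M k)) → ℝ, ∑ m, g m = ∑ r : ∀ k : {k // k ≠ j}, Fin (M k),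
      ∑ a, g ((Equiv.piSplitAt j fun k => Fin (M k)).symm (a, r)) := by
    intro g
    rw [← (Equiv.piSplitAt j fun k => Fin (M k)).symm.sum_comp, Fintype.sum_prod_type_right]
  rw [h, h, Finset.mul_sum]
  refine Finset.sum_congr rfl fun r _ => ?_
  have : ∀ a b, Function.update ((Equiv.piSplitAt j fun k => Fin (M k)).symm (a, r)) j b =
      (Equiv.piSplitAt j fun k => Fin (M k)).symm (b, r) := by
    intro a b
    ext k
    by_cases hk : k = j
    · subst hk
      simp [Equiv.piSplitAt]
    · simp [Equiv.piSplitAt, hk]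
  simp [this]

/-- A code whose receiver `j` errs with probability at most `1 / 4` has `O((τ / σ)ⁿ)` messages for
user `j`, up to an arbitrarily small exponential factor, where `τ² = P + σ²`. -/
theorem exists_card_bound {P σ : Fin 3 → ℝ} (hP : ∀ i, 0 < P i) (hσ : ∀ i, 0 < σ i)
    (H : Matrix (Fin 3) (Fin 3) ℝ) (hH : ∀ j, H j j = 1) (j : Fin 3) {t : ℝ} (ht : 0 < t) :
    ∀ᶠ n : ℕ in atTop, ∀ C : ICCode n P, (∀ k, 0 < C.M k) → C.errorProb H σ j ≤ 1 / 4 →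
      (C.M j : ℝ) ≤ 2 * ((√(P j + σ j ^ 2) / σ j) ^ n * Real.exp (n * t)) := by
  classical
  obtain ⟨K, hK, hlik⟩ := exists_likelihood_bound (hσ j) (hP j).le ht
  filter_upwards [eventually_ge_atTop 1, eventually_ge_atTop ⌈4 * K⌉₊] with n hn hnK C hM herr
  have hn' : (0 : ℝ) < n := by exact_mod_cast hn
  have hKn : K / n ≤ 1 / 4 := by
    rw [div_le_iff₀ hn']
    linarith [Nat.ceil_le.1 hnK]
  set c := (√(P j + σ j ^ 2) / σ j) ^ n * Real.exp (n * t) with hc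
  have hs := hσ j
  have hc0 : 0 ≤ c := by positivity
  have hMpos : ∀ k, (0 : ℝ) < C.M k := fun k => by exact_mod_cast hM k
  set μ := noiseLaw n (σ j) with hμ
  -- The probability of correct decoding, summed over the messages of user `j`.
  have hsucc : ∀ m : ∀ k, Fin (C.M k),
      ∑ a, μ.real {z | C.dec j (C.received H (Function.update m j a) j z) = a} ≤
        C.M j * (1 / 4) + c := by
    intro m
    set d : Fin n → ℝ := fun i => ∑ k ∈ Finset.univ.erase j, H j k * C.enc k (m k) i with hd
    have hrec : ∀ a z, C.received H (Function.update m j a) j z = (C.enc j a + z) + d := by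
      intro a z
      ext i
      simp only [ICCode.received, Pi.add_apply, hd]
      rw [← Finset.add_sum_erase _ _ (Finset.mem_univ j)]
      have : ∑ k ∈ Finset.univ.erase j, H j k * C.enc k (Function.update m j a k) i =
          ∑ k ∈ Finset.univ.erase j, H j k * C.enc k (m k) i :=
        Finset.sum_congr rfl fun k hk => by
          rw [Function.update_of_ne (Finset.ne_of_mem_erase hk)]
      rw [this, Function.update_self, hH]
      ring
    have hdec : Measurable fun y => C.dec j (y + d) :=
      (C.measurable_dec j).comp (measurable_id.add_const d)
    have hone : ∀ a, μ.real {z | C.dec j (C.received H (Function.update m j a) j z) = a} ≤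
        c * (noiseLaw n √(P j + σ j ^ 2)).real ((fun y => C.dec j (y + d)) ⁻¹' {a}) + 1 / 4 := by
      intro a
      have hx : ∑ i, C.enc j a i ^ 2 ≤ n * P j := by
        have := C.power_le j a
        rw [one_div, inv_mul_le_iff₀ hn'] at this
        exact this
      have h1 := noiseLaw_change_of_measure (hσ j) (τ := √(P j + σ j ^ 2))
        (Real.sqrt_pos.2 (by have := hP j; positivity)) (C.enc j a)
        (hdec (measurableSet_singleton a)) hc0
      have h2 := hlik n (C.enc j a) hn hx
      simp only [hrec]
      refine le_trans ?_ (h1.trans (add_le_add_right (h2.trans hKn) _))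
      exact le_of_eq rfl
    calc _ ≤ ∑ a, (c * (noiseLaw n √(P j + σ j ^ 2)).real
            ((fun y => C.dec j (y + d)) ⁻¹' {a}) + 1 / 4) := Finset.sum_le_sum fun a _ => hone a
      _ = c * ∑ a, (noiseLaw n √(P j + σ j ^ 2)).real ((fun y => C.dec j (y + d)) ⁻¹' {a}) +
            C.M j * (1 / 4) := by
          rw [Finset.sum_add_distrib, Finset.mul_sum]
          simp
      _ = c * (noiseLaw n √(P j + σ j ^ 2)).real
            ((fun y => C.dec j (y + d)) ⁻¹' ↑(Finset.univ : Finset (Fin (C.M j)))) +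
            C.M j * (1 / 4) := by
          rw [sum_measureReal_preimage_singleton _ fun a _ => hdec (measurableSet_singleton a)]
      _ ≤ c * 1 + C.M j * (1 / 4) := by
          gcongr
          exact measureReal_le_one
      _ = _ := by ring
  have hmeas : ∀ m : ∀ k, Fin (C.M k), MeasurableSet {z | C.dec j (C.received H m j z) = m j} := by
    intro m
    have : Measurable fun z => C.dec j (C.received H m j z) := by
      refine (C.measurable_dec j).comp (measurable_pi_lambda _ fun i => ?_)
      unfold ICCode.received
      fun_prop
    exact this (measurableSet_singleton _)
  have hcompl : ∀ m : ∀ k, Fin (C.M k), μ.real {z | C.dec j (C.received H m j z) ≠ m j} =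
      1 - μ.real {z | C.dec j (C.received H m j z) = m j} := fun m =>
    probReal_compl_eq_one_sub (hmeas m)
  have hcard : ((Fintype.card (∀ k, Fin (C.M k)) : ℕ) : ℝ) = ∏ k, (C.M k : ℝ) := by
    simp
  have hprod : 0 < ∏ k, (C.M k : ℝ) := Finset.prod_pos fun k _ => hMpos k
  rw [ICCode.errorProb, Finset.sum_congr rfl fun m _ => hcompl m, Finset.sum_sub_distrib,
    Finset.sum_const, Finset.card_univ, nsmul_eq_mul, mul_one, hcard, inv_mul_le_iff₀ hprod] at herr
  have hsum := sum_pi_eq_sum_update j fun m => μ.real {z | C.dec j (C.received H m j z) = m j}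
  simp only [Function.update_self] at hsum
  have hsum2 : (C.M j : ℝ) * ∑ m, μ.real {z | C.dec j (C.received H m j z) = m j} ≤
      (∏ k, (C.M k : ℝ)) * (C.M j * (1 / 4) + c) := by
    rw [hsum]
    refine (Finset.sum_le_sum fun m _ => hsucc m).trans_eq ?_
    rw [Finset.sum_const, Finset.card_univ, nsmul_eq_mul, hcard]
  have h3 : (C.M j : ℝ) * ((∏ k, (C.M k : ℝ)) * (3 / 4)) ≤
      (∏ k, (C.M k : ℝ)) * (C.M j * (1 / 4) + c) := by
    refine le_trans ?_ hsum2
    have := hMpos j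
    gcongr
    linarith
  have h4 : (C.M j : ℝ) * (3 / 4) ≤ C.M j * (1 / 4) + c := by
    refine le_of_mul_le_mul_left ?_ hprod
    linarith
  linarith

theorem Achievable.le_capacity {H : Matrix (Fin 3) (Fin 3) ℝ} {P σ R : Fin 3 → ℝ}
    (hH : ∀ j, H j j = 1) (hP : ∀ i, 0 < P i) (hσ : ∀ i, 0 < σ i) (hR : Achievable H P σ R)
    (j : Fin 3) : R j ≤ 1 / 2 * Real.logb 2 ((P j + σ j ^ 2) / σ j ^ 2) := by
  by_contra! hlt
  set C := 1 / 2 * Real.logb 2 ((P j + σ j ^ 2) / σ j ^ 2) with hC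
  have hs := hσ j
  have hPj := hP j
  set δ := (R j - C) / 3 with hδ
  have hδ0 : 0 < δ := by rw [hδ]; linarith
  have hlog2 : 0 < Real.log 2 := Real.log_pos one_lt_two
  have hbase : √(P j + σ j ^ 2) / σ j = (2 : ℝ) ^ C := by
    rw [hC, mul_comm, Real.rpow_mul two_pos.le,
      Real.rpow_logb two_pos (by norm_num) (by positivity), ← Real.sqrt_eq_rpow,
      Real.sqrt_div (by positivity), Real.sqrt_sq hs.le]
  have hexp : Real.exp (δ * Real.log 2) = (2 : ℝ) ^ δ := by
    rw [Real.rpow_def_of_pos two_pos, mul_comm]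
  have htend : Tendsto (fun n : ℕ => ((2 : ℝ) ^ δ) ^ n) atTop atTop :=
    tendsto_pow_atTop_atTop_of_one_lt (Real.one_lt_rpow one_lt_two hδ0)
  obtain ⟨n, ⟨code, hrate, herr⟩, hcard, hbig⟩ :=
    ((hR.2 δ hδ0 (1 / 4) (by norm_num)).and ((exists_card_bound hP hσ H hH j
      (mul_pos hδ0 hlog2)).and (htend.eventually_gt_atTop 2))).exists
  have hM : ∀ k, 0 < code.M k := fun k => by
    have : (0 : ℝ) < code.M k := lt_of_lt_of_le (by positivity) (hrate k)
    exact_mod_cast this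
  have h1 := (hrate j).trans (hcard code hM (herr j))
  have h2 : (2 : ℝ) ^ ((n : ℝ) * (R j - δ)) = ((2 : ℝ) ^ C) ^ n * ((2 : ℝ) ^ δ) ^ n *
      ((2 : ℝ) ^ δ) ^ n := by
    rw [← Real.rpow_natCast, ← Real.rpow_natCast, ← Real.rpow_mul two_pos.le,
      ← Real.rpow_mul two_pos.le, ← Real.rpow_add two_pos, ← Real.rpow_add two_pos]
    congr 1
    rw [hδ]
    ring
  rw [hbase, Real.exp_nat_mul, hexp, h2] at h1
  have h3 : 0 < ((2 : ℝ) ^ C) ^ n * ((2 : ℝ) ^ δ) ^ n := by positivity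
  nlinarith

theorem half_logb_one_add_le {P s : ℝ} (hP : 0 < P) (hs : 0 < s) :
    1 / 2 * Real.logb 2 ((P + s ^ 2) / s ^ 2) ≤
      max 0 (1 / 2 * Real.logb 2 (P / s ^ 2)) + 1 / 2 := by
  have h : 1 / 2 * Real.logb 2 ((P + s ^ 2) / s ^ 2) ≤
      1 / 2 * Real.logb 2 (2 * max 1 (P / s ^ 2)) := by
    gcongr
    · norm_num
    · rw [add_div, div_self (by positivity)]
      linarith [le_max_left 1 (P / s ^ 2), le_max_right 1 (P / s ^ 2)]
  rw [Real.logb_mul two_ne_zero (by positivity), Real.logb_self_eq_one one_lt_two] at h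
  rcases max_cases 1 (P / s ^ 2) with ⟨h1, -⟩ | ⟨h1, -⟩ <;> rw [h1] at h
  · rw [Real.logb_one] at h
    linarith [le_max_left 0 (1 / 2 * Real.logb 2 (P / s ^ 2))]
  · linarith [le_max_right 0 (1 / 2 * Real.logb 2 (P / s ^ 2))]

/-! ### Aligned lattice codes -/

/-- Scales `a k` of the codebooks and `b j` of the interference lattices such that at receiver `j`
the interference from user `k`, whose codewords lie in `a k • ℤⁿ`, lies in `b j • ℤⁿ`, with integer
coefficient `c j k`. By convention `c j j = 0`, as the desired signal is not interference. -/
structure IsAligned (H : Matrix (Fin 3) (Fin 3) ℝ) (a b : Fin 3 → ℝ)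
    (c : Fin 3 → Fin 3 → ℤ) : Prop where
  direct : ∀ j, H j j = 1
  a_ne : ∀ k, a k ≠ 0
  b_ne : ∀ j, b j ≠ 0
  coeff_self : ∀ j, c j j = 0
  gain : ∀ j k, k ≠ j → H j k * a k = b j * c j k

/-- The events which prevent receiver `j` from first recovering the aligned interference, treating
its own signal `a j • v` as noise, and then its own word: atypically large noise in one of the two
steps, or ambiguity of the noise in one of them. -/
def DecodingFails {n ℓ : ℕ} {ι : Type*} (T : ι → Fin n → ZMod ℓ) (s : Fin 3 → Finset ι)
    (a b : Fin 3 → ℝ) (c : Fin 3 → Fin 3 → ℤ) (r ρ : Fin 3 → ℝ) (j : Fin 3) (v : Fin n → ℤ)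
    (z : Fin n → ℝ) : Prop :=
  a j • realVec v + z ∉ rmsBall n (r j) ∨ z ∉ rmsBall n (ρ j) ∨
    (∃ k, c j k ≠ 0 ∧ Ambiguous T (s k) (b j) (r j) (a j • realVec v + z)) ∨
    Ambiguous T (s j) (a j) (ρ j) z

/-- The word `y` received at `j` is consistent with the transmission of the integer words `v`. -/
def Consistent {n : ℕ} (a b : Fin 3 → ℝ) (c : Fin 3 → Fin 3 → ℤ) (r ρ : Fin 3 → ℝ) (j : Fin 3)
    (v : Fin 3 → Fin n → ℤ) (y : Fin n → ℝ) : Prop :=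
  y - b j • realVec (∑ k, c j k • v k) ∈ rmsBall n (r j) ∧
    y - b j • realVec (∑ k, c j k • v k) - a j • realVec (v j) ∈ rmsBall n (ρ j)

theorem realVec_sub {n : ℕ} (u v : Fin n → ℤ) : realVec (u - v) = realVec u - realVec v := by
  ext i
  simp

theorem IsAligned.received_eq {H : Matrix (Fin 3) (Fin 3) ℝ} {a b : Fin 3 → ℝ}
    {c : Fin 3 → Fin 3 → ℤ} (h : IsAligned H a b c) {n : ℕ} (j : Fin 3)
    (v : Fin 3 → Fin n → ℤ) :
    (fun i => ∑ k, H j k * (a k * (v k i : ℝ))) =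
      a j • realVec (v j) + b j • realVec (∑ k, c j k • v k) := by
  ext i
  simp only [Pi.add_apply, Pi.smul_apply, realVec_apply, smul_eq_mul, Finset.sum_apply,
    Int.cast_sum, Int.cast_mul, Finset.mul_sum]
  rw [← Finset.add_sum_erase _ _ (Finset.mem_univ j),
    ← Finset.add_sum_erase Finset.univ (fun k => b j * ((c j k : ℝ) * (v k i : ℝ)))
      (Finset.mem_univ j), h.direct, h.coeff_self]
  have : ∑ k ∈ Finset.univ.erase j, H j k * (a k * (v k i : ℝ)) =
      ∑ k ∈ Finset.univ.erase j, b j * ((c j k : ℝ) * (v k i : ℝ)) :=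
    Finset.sum_congr rfl fun k hk => by
      rw [← mul_assoc, h.gain j k (Finset.ne_of_mem_erase hk), mul_assoc]
  rw [this]
  simp

/-- Unless decoding fails, all consistent hypotheses agree on the word of user `j`. The nesting of
the sets of checks makes the interference at each receiver satisfy all the checks of one user. -/
theorem eq_of_consistent {n ℓ : ℕ} {ι : Type*} {T : ι → Fin n → ZMod ℓ} {s : Fin 3 → Finset ι}
    {a b : Fin 3 → ℝ} {c : Fin 3 → Fin 3 → ℤ} {r ρ : Fin 3 → ℝ} {j : Fin 3}
    (hs : ∀ k k', s k ⊆ s k' ∨ s k' ⊆ s k) {v v' : Fin 3 → Fin n → ℤ} {z : Fin n → ℝ}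
    (hv : ∀ k, ∀ i ∈ s k, parity (T i) (v' k) = parity (T i) (v k))
    (hz : ¬ DecodingFails T s a b c r ρ j (v j) z)
    (hc : Consistent a b c r ρ j v'
      (a j • realVec (v j) + b j • realVec (∑ k, c j k • v k) + z)) : v' j = v j := by
  classical
  simp only [DecodingFails, not_or, not_not, not_exists, not_and] at hz
  obtain ⟨hz1, hz2, hz3, hz4⟩ := hz
  set u := ∑ k, c j k • v k with hu
  set u' := ∑ k, c j k • v' k with hu'
  have hdiff : u' - u = ∑ k, c j k • (v' k - v k) := by
    rw [hu, hu', ← Finset.sum_sub_distrib]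
    exact Finset.sum_congr rfl fun k _ => (smul_sub _ _ _).symm
  have hint : u' - u = 0 := by
    by_contra hne
    have hS : (Finset.univ.filter fun k => c j k ≠ 0).Nonempty := by
      by_contra hS
      rw [Finset.not_nonempty_iff_eq_empty, Finset.filter_eq_empty_iff] at hS
      refine hne (hdiff.trans (Finset.sum_eq_zero fun k _ => ?_))
      rw [not_not.1 (hS (Finset.mem_univ k)), zero_smul]
    obtain ⟨k₀, hk₀, hmin⟩ := Finset.exists_min_image _ (fun k => (s k).card) hS
    have hsub : ∀ k, c j k ≠ 0 → s k₀ ⊆ s k := by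
      intro k hk
      rcases hs k₀ k with h | h
      · exact h
      · exact (Finset.eq_of_subset_of_card_le h (hmin k (by simpa using hk))).ge
    refine hz3 k₀ (by simpa using hk₀) ⟨hz1, u' - u, hne, fun i hi => ?_, ?_⟩
    · rw [hdiff, parity_sum_mul]
      refine Finset.sum_eq_zero fun k _ => ?_
      by_cases hk : c j k = 0
      · simp [hk]
      · rw [parity_sub, hv k i (hsub k hk hi), sub_self, mul_zero]
    · convert hc.1 using 1
      rw [realVec_sub, smul_sub]
      abel
  rw [sub_eq_zero] at hint
  by_contra hne
  refine hz4 ⟨hz2, v' j - v j, sub_ne_zero.2 hne, fun i hi => ?_, ?_⟩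
  · rw [parity_sub, hv j i hi, sub_self]
  · convert hc.2 using 1
    rw [realVec_sub, smul_sub, ← hu', hint]
    abel

theorem measurableSet_consistent {n : ℕ} (a b : Fin 3 → ℝ) (c : Fin 3 → Fin 3 → ℤ)
    (r ρ : Fin 3 → ℝ) (j : Fin 3) (v : Fin 3 → Fin n → ℤ) :
    MeasurableSet {y | Consistent a b c r ρ j v y} :=
  ((measurableSet_rmsBall n (r j)).preimage (by fun_prop)).inter
    ((measurableSet_rmsBall n (ρ j)).preimage (by fun_prop))

/-- A measurable decision rule which is right whenever all hypotheses consistent with the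
observation agree with the truth. -/
theorem exists_measurable_decision {Ω ι β : Type*} [MeasurableSpace Ω] [MeasurableSpace β]
    [Finite ι] [Nonempty β] {A : ι → Set Ω} (hA : ∀ i, MeasurableSet (A i)) (g : ι → β) :
    ∃ dec : Ω → β, Measurable dec ∧
      ∀ y i, y ∈ A i → (∀ i', y ∈ A i' → g i' = g i) → dec y = g i := by
  classical
  let F : Set ι → β := fun S => if h : S.Nonempty then g h.some else Classical.arbitrary β
  refine ⟨fun y => F {i | y ∈ A i}, ?_, fun y i hi hy => ?_⟩
  · refine (measurable_of_countable F).comp (measurable_set_iff.2 fun i => ?_)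
    exact measurable_mem.2 (hA i)
  · have h : {i | y ∈ A i}.Nonempty := ⟨i, hi⟩
    simp only [F, dif_pos h]
    exact hy _ h.some_mem

theorem sum_pi_coord {M : Fin 3 → ℕ} (j : Fin 3) (f : Fin (M j) → ℝ) :
    (M j : ℝ) * ∑ m : ∀ k, Fin (M k), f (m j) = (∏ k, (M k : ℝ)) * ∑ a, f a := by
  rw [sum_pi_eq_sum_update j fun m => f (m j)]
  simp

/-- Codebooks of integer words with prescribed parities give a code for the interference channel
whose error probabilities are averages of the probabilities that decoding fails. -/
theorem exists_code {H : Matrix (Fin 3) (Fin 3) ℝ} {P σ : Fin 3 → ℝ} {a b : Fin 3 → ℝ}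
    {c : Fin 3 → Fin 3 → ℤ} (h : IsAligned H a b c) {n ℓ : ℕ} (hn : 0 < n) {ι : Type*}
    {T : ι → Fin n → ZMod ℓ} {s : Fin 3 → Finset ι} (hs : ∀ k k', s k ⊆ s k' ∨ s k' ⊆ s k)
    (r ρ : Fin 3 → ℝ) {F : Fin 3 → Finset (Fin n → ℤ)} (hF : ∀ k, (F k).Nonempty)
    (hpow : ∀ k, ∀ v ∈ F k, ∑ i, (a k * (v i : ℝ)) ^ 2 ≤ n * P k)
    (hpar : ∀ k, ∀ v ∈ F k, ∀ v' ∈ F k, ∀ i ∈ s k, parity (T i) v' = parity (T i) v) :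
    ∃ C : ICCode n P, (∀ k, C.M k = (F k).card) ∧ ∀ j, C.errorProb H σ j ≤
      (∑ v ∈ F j, (noiseLaw n (σ j)).real {z | DecodingFails T s a b c r ρ j v z}) /
        (F j).card := by
  classical
  let word : ∀ k, Fin (F k).card → (Fin n → ℤ) := fun k m => ((F k).equivFin.symm m).1
  have hword : ∀ k m, word k m ∈ F k := fun k m => ((F k).equivFin.symm m).2
  have hinj : ∀ k, Function.Injective (word k) := fun k m m' hm =>
    (F k).equivFin.symm.injective (Subtype.ext hm)
  have hne : ∀ k, Nonempty (Fin (F k).card) := fun k => ⟨⟨0, Finset.card_pos.2 (hF k)⟩⟩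
  have hdec : ∀ j, ∃ dec : (Fin n → ℝ) → Fin (F j).card, Measurable dec ∧
      ∀ y (m : ∀ k, Fin (F k).card), Consistent a b c r ρ j (fun k => word k (m k)) y →
        (∀ m' : ∀ k, Fin (F k).card, Consistent a b c r ρ j (fun k => word k (m' k)) y →
          m' j = m j) → dec y = m j := fun j =>
    exists_measurable_decision (ι := ∀ k, Fin (F k).card)
      (fun m => measurableSet_consistent a b c r ρ j fun k => word k (m k)) (fun m => m j)
  choose dec hdecm hdec using hdec
  refine ⟨⟨fun k => (F k).card, fun k m i => a k * word k m i, fun k m => ?_, dec, hdecm⟩,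
    fun k => rfl, fun j => ?_⟩
  · rw [one_div, inv_mul_le_iff₀ (by exact_mod_cast hn)]
    exact hpow k _ (hword k m)
  · set e : (Fin n → ℤ) → ℝ := fun v =>
      (noiseLaw n (σ j)).real {z | DecodingFails T s a b c r ρ j v z} with he
    have hle : ∀ m : ∀ k, Fin (F k).card, (noiseLaw n (σ j)).real {z | dec j
        (fun i => ∑ k, H j k * (a k * (word k (m k) i : ℝ)) + z i) ≠ m j} ≤
          e (word j (m j)) := by
      intro m
      refine measureReal_mono fun z hz => ?_
      by_contra hgood
      refine hz ?_
      have hy : (fun i => ∑ k, H j k * (a k * (word k (m k) i : ℝ)) + z i) =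
          a j • realVec (word j (m j)) + b j • realVec (∑ k, c j k • word k (m k)) + z := by
        rw [← h.received_eq j fun k => word k (m k)]
        rfl
      rw [hy]
      have hgood' := hgood
      simp only [Set.mem_ofPred_eq, DecodingFails, not_or, not_not] at hgood'
      refine hdec j _ m ⟨?_, ?_⟩ fun m' hm' => hinj j (eq_of_consistent hs
        (v := fun k => word k (m k)) (v' := fun k => word k (m' k))
        (fun k => hpar k _ (hword k _) _ (hword k _)) hgood hm')
      · convert hgood'.1 using 1
        abel
      · convert hgood'.2.1 using 1
        abel
    have hsum : ∑ a, e (word j a) = ∑ v ∈ F j, e v := by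
      rw [← Finset.sum_coe_sort (F j)]
      exact (F j).equivFin.symm.sum_comp fun v : F j => e v
    have hcard : ∀ k, (0 : ℝ) < (F k).card := fun k => by exact_mod_cast Finset.card_pos.2 (hF k)
    have hprod : (0 : ℝ) < ∏ k, ((F k).card : ℝ) := Finset.prod_pos fun k _ => hcard k
    have hcoord := sum_pi_coord (M := fun k => (F k).card) j fun a => e (word j a)
    simp only [hsum] at hcoord
    change (∏ k, ((F k).card : ℝ))⁻¹ * ∑ m : (∀ k, Fin (F k).card), (noiseLaw n (σ j)).real
      {z | dec j (fun i => ∑ k, H j k * (a k * (word k (m k) i : ℝ)) + z i) ≠ m j} ≤ _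
    rw [inv_mul_le_iff₀ hprod, ← mul_div_assoc, ← hcoord, mul_div_cancel_left₀ _ (hcard j).ne']
    exact Finset.sum_le_sum fun m _ => hle m

/-! ### Existence of good codes -/

theorem sum_ambiguous_le {n ℓ : ℕ} [Fact ℓ.Prime] {ι : Type*} [Fintype ι] [DecidableEq ι]
    (σ : ℝ) (s : Finset ι) {b r B : ℝ} (hb : b ≠ 0) (hr : 0 ≤ r)
    (hℓ : n * (2 * r / |b|) ^ 2 < (ℓ : ℝ) ^ 2)
    (hB : volume.real (rmsBall n (r / |b| + 1 / 2)) ≤ B * (ℓ : ℝ) ^ s.card) (x : Fin n → ℝ) :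
    ∑ T : ι → Fin n → ZMod ℓ, (noiseLaw n σ).real {z | Ambiguous T s b r (x + z)} ≤
      B * Fintype.card (ι → Fin n → ZMod ℓ) := by
  classical
  refine sum_measureReal_le_of_card_le _
    (fun T => (measurableSet_ambiguous T s b r).preimage (measurable_const_add x)) fun z => ?_
  have hℓ0 : (0 : ℝ) < (ℓ : ℝ) ^ s.card := by
    have := (Fact.out : ℓ.Prime).pos
    positivity
  have h := card_ambiguous_le s hb hr hℓ (x + z)
  have h1 : ∑ T : ι → Fin n → ZMod ℓ,
      ({z | Ambiguous T s b r (x + z)} : Set (Fin n → ℝ)).indicator (fun _ => (1 : ℝ)) z =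
      (Finset.univ.filter fun T : ι → Fin n → ZMod ℓ => Ambiguous T s b r (x + z)).card := by
    simp [Set.indicator_apply, Finset.sum_boole]
  refine le_of_mul_le_mul_right ?_ hℓ0
  refine le_trans (le_of_eq (congrArg (· * (ℓ : ℝ) ^ s.card) h1)) (h.trans ?_)
  calc _ ≤ B * (ℓ : ℝ) ^ s.card * Fintype.card (ι → Fin n → ZMod ℓ) := by gcongr
    _ = _ := by ring

/-- For a fixed word and random checks, decoding fails on average with probability at most
`2 * η + 4 * B`, where `η` bounds the probability of large noise and `B` that of ambiguity, for
the three users whose checks the interference may satisfy and for the word itself. -/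
theorem sum_decodingFails_le {n ℓ : ℕ} [Fact ℓ.Prime] {ι : Type*} [Fintype ι] [DecidableEq ι]
    {σ : ℝ} {s : Fin 3 → Finset ι} {a b : Fin 3 → ℝ} {c : Fin 3 → Fin 3 → ℤ} {r ρ : Fin 3 → ℝ}
    {j : Fin 3} {B η : ℝ} (hB0 : 0 ≤ B) (ha : a j ≠ 0) (hb : b j ≠ 0) (hr : 0 ≤ r j)
    (hρ : 0 ≤ ρ j) (hℓr : ∀ k, c j k ≠ 0 → n * (2 * r j / |b j|) ^ 2 < (ℓ : ℝ) ^ 2)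
    (hℓρ : n * (2 * ρ j / |a j|) ^ 2 < (ℓ : ℝ) ^ 2)
    (hBr : ∀ k, c j k ≠ 0 →
      volume.real (rmsBall n (r j / |b j| + 1 / 2)) ≤ B * (ℓ : ℝ) ^ (s k).card)
    (hBρ : volume.real (rmsBall n (ρ j / |a j| + 1 / 2)) ≤ B * (ℓ : ℝ) ^ (s j).card)
    (v : Fin n → ℤ)
    (hη : (noiseLaw n σ).real {z | a j • realVec v + z ∉ rmsBall n (r j)} ≤ η)
    (hη' : (noiseLaw n σ).real {z | z ∉ rmsBall n (ρ j)} ≤ η) :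
    ∑ T : ι → Fin n → ZMod ℓ, (noiseLaw n σ).real {z | DecodingFails T s a b c r ρ j v z} ≤
      (2 * η + 4 * B) * Fintype.card (ι → Fin n → ZMod ℓ) := by
  classical
  have hsplit : ∀ T : ι → Fin n → ZMod ℓ,
      (noiseLaw n σ).real {z | DecodingFails T s a b c r ρ j v z} ≤ η + (η +
        (∑ k, (noiseLaw n σ).real
          {z | c j k ≠ 0 ∧ Ambiguous T (s k) (b j) (r j) (a j • realVec v + z)} +
          (noiseLaw n σ).real {z | Ambiguous T (s j) (a j) (ρ j) (0 + z)})) := by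
    intro T
    refine (measureReal_union_le _ _).trans (add_le_add hη ?_)
    refine (measureReal_union_le _ _).trans (add_le_add hη' ?_)
    refine (measureReal_union_le _ _).trans (add_le_add ?_ ?_)
    · refine le_trans (le_of_eq ?_) (measureReal_iUnion_fintype_le _)
      congr 1
      ext z
      simp only [Set.mem_iUnion]
      exact Iff.rfl
    · simp only [zero_add]
      exact le_of_eq rfl
  have hown := sum_ambiguous_le σ (s j) ha hρ hℓρ hBρ 0
  have hint : ∀ k, ∑ T : ι → Fin n → ZMod ℓ, (noiseLaw n σ).real
      {z | c j k ≠ 0 ∧ Ambiguous T (s k) (b j) (r j) (a j • realVec v + z)} ≤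
        B * Fintype.card (ι → Fin n → ZMod ℓ) := by
    intro k
    by_cases hk : c j k = 0
    · simp only [hk, ne_eq, not_true_eq_false, false_and, Set.ofPred_false, measureReal_empty,
        Finset.sum_const_zero]
      positivity
    · simpa only [ne_eq, hk, not_false_eq_true, true_and] using
        sum_ambiguous_le σ (s k) hb hr (hℓr k hk) (hBr k hk) (a j • realVec v)
  refine (Finset.sum_le_sum fun T _ => hsplit T).trans ?_
  rw [Finset.sum_add_distrib, Finset.sum_add_distrib, Finset.sum_add_distrib, Finset.sum_comm,
    Finset.sum_const, Finset.card_univ, nsmul_eq_mul]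
  have := Finset.sum_le_sum fun k (_ : k ∈ (Finset.univ : Finset (Fin 3))) => hint k
  rw [Finset.sum_const, Finset.card_univ, Fintype.card_fin, nsmul_eq_mul] at this
  push_cast at this
  linarith

/-- Codes of a given length from random parity checks: `m k` checks for user `k` leave at least
the fraction `ℓ ^ (-m k) / 2` of the lattice points in the ball of radius `√(P k)`. -/
theorem exists_code_of_checks {H : Matrix (Fin 3) (Fin 3) ℝ} {P σ : Fin 3 → ℝ} {a b : Fin 3 → ℝ}
    {c : Fin 3 → Fin 3 → ℤ} (h : IsAligned H a b c) (hP : ∀ i, 0 < P i) {n ℓ : ℕ} (hn : 0 < n)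
    [Fact ℓ.Prime] (m : Fin 3 → ℕ) {r ρ : Fin 3 → ℝ} {B η : ℝ} (hB0 : 0 < B) (hη0 : 0 ≤ η)
    (hr : ∀ j, 0 ≤ r j) (hρ : ∀ j, 0 ≤ ρ j)
    (hℓr : ∀ j k, c j k ≠ 0 → n * (2 * r j / |b j|) ^ 2 < (ℓ : ℝ) ^ 2)
    (hℓρ : ∀ j, n * (2 * ρ j / |a j|) ^ 2 < (ℓ : ℝ) ^ 2)
    (hBr : ∀ j k, c j k ≠ 0 →
      volume.real (rmsBall n (r j / |b j| + 1 / 2)) ≤ B * (ℓ : ℝ) ^ m k)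
    (hBρ : ∀ j, volume.real (rmsBall n (ρ j / |a j| + 1 / 2)) ≤ B * (ℓ : ℝ) ^ m j)
    (hη : ∀ j (x : Fin n → ℝ), ∑ i, x i ^ 2 ≤ n * P j →
      (noiseLaw n (σ j)).real {z | x + z ∉ rmsBall n (r j)} ≤ η)
    (hη' : ∀ j, (noiseLaw n (σ j)).real {z | z ∉ rmsBall n (ρ j)} ≤ η)
    (hPa : ∀ k, 1 / 2 ≤ √(P k) / |a k|) :
    ∃ C : ICCode n P, (∀ k, 0 < C.M k) ∧
      (∀ k, volume.real (rmsBall n (√(P k) / |a k| - 1 / 2)) / (2 * (ℓ : ℝ) ^ m k) ≤ C.M k) ∧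
      ∀ j, C.errorProb H σ j ≤ 6 * (2 * η + 4 * B) := by
  classical
  set N := ∑ k, m k with hN
  have hmN : ∀ k, m k ≤ N := fun k =>
    Finset.single_le_sum (f := m) (fun _ _ => Nat.zero_le _) (Finset.mem_univ k)
  set s : Fin 3 → Finset (Fin N) := fun k => Finset.univ.filter fun i => i.1 < m k with hs
  have hscard : ∀ k, (s k).card = m k := by
    intro k
    rw [hs]
    simp only [Fin.card_filter_val_lt]
    exact min_eq_right (hmN k)
  have hschain : ∀ k k', s k ⊆ s k' ∨ s k' ⊆ s k := by
    intro k k'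
    rcases le_total (m k) (m k') with hk | hk
    · left
      intro i hi
      simp only [hs, Finset.mem_filter, Finset.mem_univ, true_and] at hi ⊢
      omega
    · right
      intro i hi
      simp only [hs, Finset.mem_filter, Finset.mem_univ, true_and] at hi ⊢
      omega
  set ε₀ := 2 * η + 4 * B with hε₀
  have hε₀pos : 0 < ε₀ := by positivity
  set G : Fin 3 → Finset (Fin n → ℤ) := fun k =>
    (latticePoints_finite 0 (√(P k) / |a k|)).toFinset with hG
  have hGmem : ∀ k u, u ∈ G k ↔ realVec u ∈ rmsBall n (√(P k) / |a k|) := by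
    intro k u
    simp only [hG, Set.Finite.mem_toFinset, latticePoints, Set.mem_ofPred_eq, zero_sub]
    exact ⟨fun h => by simpa using neg_mem_rmsBall h, neg_mem_rmsBall⟩
  have hGpow : ∀ k, ∀ u ∈ G k, ∑ i, (a k * (u i : ℝ)) ^ 2 ≤ n * P k := by
    intro k u hu
    have h1 := (hGmem k u).1 hu
    rw [mem_rmsBall, div_pow, sq_abs, Real.sq_sqrt (hP k).le] at h1
    simp only [realVec_apply] at h1
    have ha := h.a_ne k
    simp only [mul_pow, ← Finset.mul_sum]
    calc _ ≤ a k ^ 2 * (n * (P k / a k ^ 2)) := by gcongr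
      _ = _ := by field_simp
  have hGne : ∀ k, (G k).Nonempty := fun k => ⟨0, (hGmem k 0).2 (by
    simp only [mem_rmsBall, realVec_apply, Pi.zero_apply, Int.cast_zero]
    simp
    positivity)⟩
  have hGpos : ∀ k, (0 : ℝ) < (G k).card := fun k => by
    exact_mod_cast Finset.card_pos.2 (hGne k)
  set e : (Fin N → Fin n → ZMod ℓ) → Fin 3 → (Fin n → ℤ) → ℝ := fun T j v =>
    (noiseLaw n (σ j)).real {z | DecodingFails T s a b c r ρ j v z} with he
  have havg : ∀ j, ∀ v ∈ G j, ∑ T, e T j v ≤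
      ε₀ * Fintype.card (Fin N → Fin n → ZMod ℓ) := by
    intro j v hv
    exact sum_decodingFails_le hB0.le (h.a_ne j) (h.b_ne j) (hr j) (hρ j) (hℓr j) (hℓρ j)
      (fun k hk => by rw [hscard]; exact hBr j k hk) (by rw [hscard]; exact hBρ j) v
      (hη j _ (hGpow j v hv)) (hη' j)
  -- One choice of the checks serves all three receivers.
  obtain ⟨T, hT⟩ : ∃ T, ∑ j, (∑ v ∈ G j, e T j v) / (G j).card ≤ 3 * ε₀ := by
    have hle : ∑ T, ∑ j, (∑ v ∈ G j, e T j v) / (G j).card ≤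
        ∑ _T : Fin N → Fin n → ZMod ℓ, 3 * ε₀ := by
      rw [Finset.sum_comm, Finset.sum_const, Finset.card_univ, nsmul_eq_mul]
      calc _ ≤ ∑ _j : Fin 3, ε₀ * Fintype.card (Fin N → Fin n → ZMod ℓ) := by
            refine Finset.sum_le_sum fun j _ => ?_
            rw [← Finset.sum_div, div_le_iff₀ (hGpos j), Finset.sum_comm]
            refine (Finset.sum_le_sum fun v hv => havg j v hv).trans_eq ?_
            rw [Finset.sum_const, nsmul_eq_mul]
            ring
        _ = _ := by
            rw [Finset.sum_const, Finset.card_univ, Fintype.card_fin, nsmul_eq_mul]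
            push_cast
            ring
    obtain ⟨T, -, hT⟩ := Finset.exists_le_of_sum_le Finset.univ_nonempty hle
    exact ⟨T, hT⟩
  have hTj : ∀ j, ∑ v ∈ G j, e T j v ≤ 3 * ε₀ * (G j).card := by
    intro j
    rw [← div_le_iff₀ (hGpos j)]
    refine le_trans ?_ hT
    exact Finset.single_le_sum (f := fun j => (∑ v ∈ G j, e T j v) / (G j).card)
      (fun j _ => div_nonneg (Finset.sum_nonneg fun v _ => measureReal_nonneg) (hGpos j).le)
      (Finset.mem_univ j)
  choose t ht1 ht2 using fun k => exists_good_fiber (τ := s k → ZMod ℓ) (hGne k)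
    (fun v i => parity (T i) v) (by positivity) (hTj k) (fun v => measureReal_nonneg)
  -- The prescribed parities `t k` are chosen after the checks, one user at a time: the error at
  -- receiver `j` depends on the words of user `j` only.
  set F : Fin 3 → Finset (Fin n → ℤ) := fun k =>
    (G k).filter fun v => (fun i : s k => parity (T i) v) = t k with hF
  have hFpos : ∀ k, (0 : ℝ) < (F k).card := fun k => by
    refine lt_of_lt_of_le ?_ (ht1 k)
    have : (0 : ℝ) < Fintype.card (s k → ZMod ℓ) := by exact_mod_cast Fintype.card_pos
    have := hGpos k
    positivity
  obtain ⟨C, hCM, hCe⟩ := exists_code (P := P) (σ := σ) h hn (T := T) hschain r ρ (F := F)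
    (fun k => Finset.card_pos.1 (by exact_mod_cast hFpos k))
    (fun k v hv => hGpow k v (Finset.mem_filter.1 hv).1)
    (fun k v hv v' hv' i hi => by
      have h1 := congrFun (Finset.mem_filter.1 hv).2 ⟨i, hi⟩
      have h2 := congrFun (Finset.mem_filter.1 hv').2 ⟨i, hi⟩
      exact h2.trans h1.symm)
  refine ⟨C, fun k => ?_, fun k => ?_, fun j => (hCe j).trans ?_⟩
  · rw [hCM]
    exact_mod_cast hFpos k
  · rw [hCM]
    refine le_trans ?_ (ht1 k)
    have hcard : (Fintype.card (s k → ZMod ℓ) : ℝ) = (ℓ : ℝ) ^ m k := by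
      rw [Fintype.card_fun, ZMod.card, Fintype.card_coe, hscard]
      push_cast
      rfl
    rw [hcard]
    gcongr
    refine volume_le_card_of_latticePoints_subset (by linarith [hPa k]) fun u hu => ?_
    rw [hGmem]
    simpa using hu
  · rw [div_le_iff₀ (hFpos j)]
    refine (ht2 j).trans_eq ?_
    ring

theorem IsAligned.smul {H : Matrix (Fin 3) (Fin 3) ℝ} {a b : Fin 3 → ℝ} {c : Fin 3 → Fin 3 → ℤ}
    (h : IsAligned H a b c) {θ : ℝ} (hθ : θ ≠ 0) : IsAligned H (θ • a) (θ • b) c where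
  direct := h.direct
  a_ne k := mul_ne_zero hθ (h.a_ne k)
  b_ne j := mul_ne_zero hθ (h.b_ne j)
  coeff_self := h.coeff_self
  gain j k hjk := by
    simp only [Pi.smul_apply, smul_eq_mul]
    linear_combination θ * h.gain j k hjk

/-- As the grid is refined, the ratio of the radii of the codeword ball and of the decoding ball,
both corrected for the size of a grid cell, tends to `√P / σ`. -/
theorem eventually_radius_ratio {P σ a δ : ℝ} (hP : 0 < P) (hσ : 0 < σ) (ha : a ≠ 0)
    (hδ : 0 < δ) : ∀ᶠ θ : ℝ in 𝓝[>] 0, 1 / 2 < √P / |θ * a| ∧ √P / σ * 2 ^ (-δ) <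
      (√P / |θ * a| - 1 / 2) / ((√((0 + σ ^ 2) * (1 + θ)) / |θ * a| + 1 / 2) * (1 + θ)) := by
  have hsP : 0 < √P := Real.sqrt_pos.2 hP
  have hlim : Tendsto (fun θ : ℝ => (√P - θ * |a| / 2) /
      ((√((0 + σ ^ 2) * (1 + θ)) + θ * |a| / 2) * (1 + θ))) (𝓝[>] 0) (𝓝 (√P / σ)) := by
    have hc : ContinuousAt (fun θ : ℝ => (√P - θ * |a| / 2) /
        ((√((0 + σ ^ 2) * (1 + θ)) + θ * |a| / 2) * (1 + θ))) 0 := by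
      refine ContinuousAt.div (by fun_prop) (by fun_prop) ?_
      simp [Real.sqrt_sq hσ.le, hσ.ne']
    have := hc.tendsto
    simp only [zero_mul, zero_div, sub_zero, add_zero, mul_one, zero_add,
      Real.sqrt_sq hσ.le] at this
    simpa only [zero_add] using this.mono_left nhdsWithin_le_nhds
  have hlt : √P / σ * 2 ^ (-δ) < √P / σ := by
    refine mul_lt_of_lt_one_right (by positivity) ?_
    exact Real.rpow_lt_one_of_one_lt_of_neg one_lt_two (by linarith)
  have hsmall : ∀ᶠ θ : ℝ in 𝓝[>] 0, θ * |a| / 2 < √P := by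
    have hc : Tendsto (fun θ : ℝ => θ * |a| / 2) (𝓝[>] 0) (𝓝 (0 * |a| / 2)) :=
      (Continuous.tendsto (by fun_prop) 0).mono_left nhdsWithin_le_nhds
    exact hc.eventually_lt_const (by simpa using hsP)
  filter_upwards [hlim.eventually_const_lt hlt, hsmall, self_mem_nhdsWithin] with θ h1 h2 hθ
  have hθ' : (0 : ℝ) < θ := hθ
  have ha' : 0 < |a| := abs_pos.2 ha
  rw [abs_mul, abs_of_pos hθ']
  refine ⟨?_, ?_⟩
  · rw [lt_div_iff₀ (by positivity)]
    linarith
  · have key : ∀ A B t κ : ℝ, 0 < t → (A / t - 1 / 2) / ((B / t + 1 / 2) * κ) =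
        (A - t / 2) / ((B + t / 2) * κ) := by
      intro A B t κ ht
      rw [show A / t - 1 / 2 = (A - t / 2) / t by field_simp,
        show B / t + 1 / 2 = (B + t / 2) / t by field_simp, div_mul_eq_mul_div,
        div_div_div_cancel_right₀ ht.ne']
    rw [key _ _ _ _ (by positivity)]
    exact h1

/-- Alignment with sufficiently strong interference makes all rates up to
`max 0 (log₂ (P / σ²) / 2)` achievable. -/
theorem IsAligned.achievable {H : Matrix (Fin 3) (Fin 3) ℝ} {P σ : Fin 3 → ℝ} {a b : Fin 3 → ℝ}
    {c : Fin 3 → Fin 3 → ℤ} (h : IsAligned H a b c) (hP : ∀ i, 0 < P i) (hσ : ∀ i, 0 < σ i)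
    (hstrong : ∀ j k, c j k ≠ 0 → a k ^ 2 * (P j + σ j ^ 2) ≤ b j ^ 2 * σ k ^ 2)
    {R : Fin 3 → ℝ} (hR : ∀ i, 0 ≤ R i ∧ R i ≤ max 0 (1 / 2 * Real.logb 2 (P i / σ i ^ 2))) :
    Achievable H P σ R := by
  refine ⟨fun k => (hR k).1, fun δ hδ ε hε => ?_⟩
  -- `θ` serves both as the mesh of the grid and as the relative margin of the decoding radii.
  obtain ⟨θ, hθ, hθ0⟩ := ((eventually_all.2 fun k => eventually_radius_ratio (hP k) (hσ k)
    (h.a_ne k) (half_pos hδ)).and self_mem_nhdsWithin).exists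
  have hθ0' : (0 : ℝ) < θ := hθ0
  set α : Fin 3 → ℝ := θ • a with hα
  set β : Fin 3 → ℝ := θ • b with hβ
  have hal : IsAligned H α β c := h.smul hθ0'.ne'
  change ∀ k, 1 / 2 < √(P k) / |α k| ∧ √(P k) / σ k * 2 ^ (-(δ / 2)) < (√(P k) / |α k| - 1 / 2) /
    ((√((0 + σ k ^ 2) * (1 + θ)) / |α k| + 1 / 2) * (1 + θ)) at hθ
  set r : Fin 3 → ℝ := fun j => √((P j + σ j ^ 2) * (1 + θ)) with hr
  set ρ : Fin 3 → ℝ := fun j => √((0 + σ j ^ 2) * (1 + θ)) with hρ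
  have hαpos : ∀ k, 0 < |α k| := fun k => abs_pos.2 (hal.a_ne k)
  have hβpos : ∀ k, 0 < |β k| := fun k => abs_pos.2 (hal.b_ne k)
  have hrρ : ∀ j k, c j k ≠ 0 → r j / |β j| ≤ ρ k / |α k| := by
    intro j k hk
    rw [div_le_div_iff₀ (hβpos j) (hαpos k)]
    have hPj := hP j
    refine (sq_le_sq₀ (by positivity) (by positivity)).1 ?_
    rw [mul_pow, mul_pow, Real.sq_sqrt (by positivity), Real.sq_sqrt (by positivity), sq_abs,
      sq_abs]
    have := mul_le_mul_of_nonneg_left (hstrong j k hk)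
      (show 0 ≤ θ ^ 2 * (1 + θ) by positivity)
    simp only [hα, hβ, Pi.smul_apply, smul_eq_mul]
    linarith
  choose K hK0 hK using fun j => exists_noise_ball_bound (σ j) (P j) θ (hP j).le (hσ j) hθ0'
  choose L hL0 hL using fun j => exists_noise_ball_bound (σ j) 0 θ le_rfl (hσ j) hθ0'
  set Q := ∑ j, (K j + L j) with hQ
  have hKL : ∀ j, K j ≤ Q ∧ L j ≤ Q := by
    intro j
    have : K j + L j ≤ Q := Finset.single_le_sum (f := fun j => K j + L j)
      (fun j _ => add_nonneg (hK0 j) (hL0 j)) (Finset.mem_univ j)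
    constructor <;> linarith [hK0 j, hL0 j]
  have hQ0 : 0 ≤ Q := Finset.sum_nonneg fun j _ => add_nonneg (hK0 j) (hL0 j)
  have herr : Tendsto (fun n : ℕ => 6 * (2 * (Q / n) + 4 * (1 + θ)⁻¹ ^ n)) atTop (𝓝 0) := by
    have h1 : Tendsto (fun n : ℕ => Q / n) atTop (𝓝 0) := tendsto_const_div_atTop_nhds_zero_nat Q
    have h2 : Tendsto (fun n : ℕ => (1 + θ)⁻¹ ^ n) atTop (𝓝 0) :=
      tendsto_pow_atTop_nhds_zero_of_lt_one (by positivity) (inv_lt_one_of_one_lt₀ (by linarith))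
    simpa using ((h1.const_mul 2).add (h2.const_mul 4)).const_mul 6
  have hgrow : ∀ᶠ n : ℕ in atTop, 4 * (n : ℝ) ≤ ((2 : ℝ) ^ (δ / 2)) ^ n := by
    have h1 := tendsto_pow_const_div_const_pow_of_one_lt 1
      (Real.one_lt_rpow one_lt_two (half_pos hδ))
    filter_upwards [h1.eventually_lt_const (show (0 : ℝ) < 1 / 4 by norm_num)] with n hn
    rw [pow_one, div_lt_iff₀ (by positivity)] at hn
    linarith
  have hlarge : ∀ᶠ n : ℕ in atTop, ∀ k, (2 * (ρ k / |α k|)) ^ 2 < (n : ℝ) :=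
    eventually_all.2 fun k => tendsto_natCast_atTop_atTop.eventually_gt_atTop _
  filter_upwards [eventually_ge_atTop 1, herr.eventually_le_const hε, hgrow, hlarge] with
    n hn hnε hngrow hnlarge
  have hn' : (0 : ℝ) < n := by exact_mod_cast hn
  obtain ⟨ℓ, hℓp, hnℓ, hℓn⟩ := Nat.exists_prime_lt_and_le_two_mul n (by omega)
  have : Fact ℓ.Prime := ⟨hℓp⟩
  have hℓ1 : (1 : ℝ) < ℓ := by exact_mod_cast hℓp.one_lt
  have hℓ2 : (ℓ : ℝ) ≤ 2 * n := by exact_mod_cast hℓn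
  have hℓsq : ∀ x : ℝ, 0 ≤ x → ∀ k, x ≤ ρ k / |α k| → n * (2 * x) ^ 2 < (ℓ : ℝ) ^ 2 := by
    intro x hx k hxk
    have h1 : (2 * x) ^ 2 ≤ (2 * (ρ k / |α k|)) ^ 2 := by gcongr
    have h2 : (n : ℝ) < ℓ := by exact_mod_cast hnℓ
    calc (n : ℝ) * (2 * x) ^ 2 ≤ n * n := by
          gcongr
          exact h1.trans (hnlarge k).le
      _ < (ℓ : ℝ) ^ 2 := by
          rw [sq]
          exact mul_self_lt_mul_self hn'.le h2
  set V : Fin 3 → ℝ := fun k => volume.real (rmsBall n (ρ k / |α k| + 1 / 2)) with hV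
  have hρα : ∀ k, 0 ≤ ρ k / |α k| := fun k => by positivity
  have hV1 : ∀ k, 1 ≤ V k := fun k => one_le_volume_real_rmsBall (by linarith [hρα k])
  -- The least number of checks that makes ambiguity exponentially unlikely: rounding costs at most
  -- a factor `ℓ ≤ 2 * n`, which does not affect the rate.
  have hm : ∀ k, ∃ m : ℕ, V k * (1 + θ) ^ n ≤ (ℓ : ℝ) ^ m ∧
      (ℓ : ℝ) ^ m ≤ ℓ * (V k * (1 + θ) ^ n) := by
    intro k
    obtain ⟨m, hm1, hm2⟩ := exists_nat_pow_near
      (one_le_mul_of_one_le_of_one_le (hV1 k) (one_le_pow₀ (by linarith) :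
        (1 : ℝ) ≤ (1 + θ) ^ n)) hℓ1
    refine ⟨m + 1, hm2.le, ?_⟩
    rw [pow_succ, mul_comm]
    gcongr
  choose m hm1 hm2 using hm
  have hVm : ∀ k, V k ≤ (1 + θ)⁻¹ ^ n * (ℓ : ℝ) ^ m k := by
    intro k
    rw [inv_pow, ← div_eq_inv_mul, le_div_iff₀ (by positivity)]
    exact hm1 k
  obtain ⟨C, hC1, hC2, hC3⟩ := exists_code_of_checks (σ := σ) hal hP hn m (r := r) (ρ := ρ)
    (B := (1 + θ)⁻¹ ^ n) (η := Q / n) (by positivity) (by positivity)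
    (fun j => Real.sqrt_nonneg _) (fun j => Real.sqrt_nonneg _)
    (fun j k hk => by
      rw [mul_div_assoc]
      exact hℓsq _ (by positivity) k (hrρ j k hk))
    (fun j => by
      rw [mul_div_assoc]
      exact hℓsq _ (hρα j) j le_rfl)
    (fun j k hk => by
      refine le_trans ?_ (hVm k)
      refine ENNReal.toReal_mono (volume_rmsBall_ne_top _ _)
        (measure_mono (rmsBall_mono (by positivity) ?_))
      linarith [hrρ j k hk])
    hVm
    (fun j x hx => (hK j n x hn hx).trans (by gcongr; exact (hKL j).1))
    (fun j => by
      have := hL j n 0 hn (by simp)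
      simp only [zero_add] at this
      refine le_trans ?_ (this.trans (show L j / n ≤ Q / n by gcongr; exact (hKL j).2))
      simp only [hρ, zero_add]
      exact le_rfl)
    (fun k => (hθ k).1.le)
  refine ⟨C, fun k => ?_, fun j => (hC3 j).trans hnε⟩
  -- At rate zero, where `P k` may be below the noise level, a single message suffices.
  rcases le_or_gt (R k) 0 with hRk | hRk
  · calc (2 : ℝ) ^ ((n : ℝ) * (R k - δ)) ≤ 1 :=
          Real.rpow_le_one_of_one_le_of_nonpos one_le_two
            (mul_nonpos_of_nonneg_of_nonpos hn'.le (by linarith))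
      _ ≤ C.M k := by exact_mod_cast hC1 k
  · have hRL : R k ≤ 1 / 2 * Real.logb 2 (P k / σ k ^ 2) := by
      rcases le_max_iff.1 (hR k).2 with h0 | h0
      · linarith
      · exact h0
    have hs := hσ k
    have hPk := hP k
    have hbase : (2 : ℝ) ^ R k ≤ √(P k) / σ k := by
      calc (2 : ℝ) ^ R k ≤ 2 ^ (1 / 2 * Real.logb 2 (P k / σ k ^ 2)) :=
            Real.rpow_le_rpow_of_exponent_le one_le_two hRL
        _ = _ := by
            rw [mul_comm, Real.rpow_mul two_pos.le,
              Real.rpow_logb two_pos (by norm_num) (by positivity), ← Real.sqrt_eq_rpow,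
              Real.sqrt_div hPk.le, Real.sqrt_sq hs.le]
    refine le_trans ?_ (hC2 k)
    set x := √(P k) / |α k| - 1 / 2 with hx
    set y := ρ k / |α k| + 1 / 2 with hy
    have hxpos : 0 < x := by linarith [(hθ k).1]
    have hypos : 0 < y := by linarith [hρα k]
    have hratio : (2 : ℝ) ^ (R k - δ / 2) ≤ x / (y * (1 + θ)) := by
      rw [sub_eq_add_neg, Real.rpow_add two_pos]
      exact (mul_le_mul_of_nonneg_right hbase (by positivity)).trans (hθ k).2.le
    have hvol1 : 0 < volume.real (rmsBall n 1) :=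
      one_pos.trans_le (one_le_volume_real_rmsBall (by norm_num))
    have hden : 2 * (ℓ : ℝ) ^ m k ≤
        4 * n * (y ^ n * volume.real (rmsBall n 1) * (1 + θ) ^ n) := by
      have h1 := hm2 k
      simp only [hV] at h1
      rw [← hy, volume_real_rmsBall hypos] at h1
      have h2 : (ℓ : ℝ) * (y ^ n * volume.real (rmsBall n 1) * (1 + θ) ^ n) ≤
          2 * n * (y ^ n * volume.real (rmsBall n 1) * (1 + θ) ^ n) := by gcongr
      linarith
    calc (2 : ℝ) ^ ((n : ℝ) * (R k - δ))
        = (2 ^ (R k - δ / 2)) ^ n / (2 ^ (δ / 2)) ^ n := by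
          rw [← Real.rpow_natCast, ← Real.rpow_natCast, ← Real.rpow_mul two_pos.le,
            ← Real.rpow_mul two_pos.le, ← Real.rpow_sub two_pos]
          congr 1
          ring
      _ ≤ (x / (y * (1 + θ))) ^ n / (4 * n) := by gcongr
      _ = x ^ n * volume.real (rmsBall n 1) /
          (4 * n * (y ^ n * volume.real (rmsBall n 1) * (1 + θ) ^ n)) := by
          rw [div_pow, mul_pow]
          field_simp
      _ ≤ volume.real (rmsBall n x) / (2 * (ℓ : ℝ) ^ m k) := by
          rw [volume_real_rmsBall hxpos]
          gcongr

/-! ### Channels in the class are aligned -/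

/-- Codebook scales solving the alignment equations between the two interferers at each receiver
make all rates up to `max 0 (log₂ (P / σ²) / 2)` achievable. -/
theorem achievable_of_alignment_equations {H : Matrix (Fin 3) (Fin 3) ℝ} (hd : ∀ j, H j j = 1)
    {P σ : Fin 3 → ℝ} (hP : ∀ i, 0 < P i) (hσ : ∀ i, 0 < σ i) (a : Fin 3 → ℝ)
    (ha : ∀ k, a k ≠ 0) (c : Fin 3 → Fin 3 → ℤ) (hcd : ∀ j, c j j = 0)
    (hH10 : H 1 0 ≠ 0) (hH21 : H 2 1 ≠ 0) (hH02 : H 0 2 ≠ 0)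
    (hc10 : c 1 0 ≠ 0) (hc21 : c 2 1 ≠ 0) (hc02 : c 0 2 ≠ 0)
    (h0 : H 0 1 * a 1 * c 0 2 = H 0 2 * a 2 * c 0 1)
    (h1 : H 1 2 * a 2 * c 1 0 = H 1 0 * a 0 * c 1 2)
    (h2 : H 2 0 * a 0 * c 2 1 = H 2 1 * a 1 * c 2 0)
    (hstrong : ∀ j k, k ≠ j → (c j k : ℝ) ^ 2 * ((P j + σ j ^ 2) / σ k ^ 2) ≤ H j k ^ 2)
    {R : Fin 3 → ℝ} (hR : ∀ i, 0 ≤ R i ∧ R i ≤ max 0 (1 / 2 * Real.logb 2 (P i / σ i ^ 2))) :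
    Achievable H P σ R := by
  have hc10' : (c 1 0 : ℝ) ≠ 0 := by exact_mod_cast hc10
  have hc21' : (c 2 1 : ℝ) ≠ 0 := by exact_mod_cast hc21
  have hc02' : (c 0 2 : ℝ) ≠ 0 := by exact_mod_cast hc02
  have ha0 := ha 0
  have ha1 := ha 1
  have ha2 := ha 2
  have hal : IsAligned H a
      ![H 0 2 * a 2 / c 0 2, H 1 0 * a 0 / c 1 0, H 2 1 * a 1 / c 2 1] c := by
    refine ⟨hd, ha, fun j => ?_, hcd, fun j k hjk => ?_⟩
    · fin_cases j
      · exact div_ne_zero (mul_ne_zero hH02 ha2) hc02'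
      · exact div_ne_zero (mul_ne_zero hH10 ha0) hc10'
      · exact div_ne_zero (mul_ne_zero hH21 ha1) hc21'
    · fin_cases j <;> fin_cases k <;>
        simp only [ne_eq, not_true_eq_false, Fin.zero_eta, Fin.mk_one, Fin.reduceFinMk,
          Fin.isValue, Matrix.cons_val] at hjk ⊢ <;>
        field_simp <;> assumption
  refine hal.achievable hP hσ (fun j k hk => ?_) hR
  have hkj : k ≠ j := by
    rintro rfl
    exact hk (hcd k)
  have hk' : (c j k : ℝ) ≠ 0 := by exact_mod_cast hk
  have hs := hσ k
  have h := mul_le_mul_of_nonneg_right (hstrong j k hkj) (sq_nonneg (a k))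
  rw [← mul_pow, hal.gain j k hkj] at h
  have h' : (c j k : ℝ) ^ 2 * (a k ^ 2 * (P j + σ j ^ 2) / σ k ^ 2) ≤
      (c j k : ℝ) ^ 2 *
        (![H 0 2 * a 2 / c 0 2, H 1 0 * a 0 / c 1 0, H 2 1 * a 1 / c 2 1] j) ^ 2 := by
    calc _ = (c j k : ℝ) ^ 2 * ((P j + σ j ^ 2) / σ k ^ 2) * a k ^ 2 := by ring
      _ ≤ _ := h
      _ = _ := by ring
  have h'' := le_of_mul_le_mul_left h' (by positivity)
  rwa [div_le_iff₀ (by positivity)] at h''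

theorem mainTheorem3
    (H : Matrix (Fin 3) (Fin 3) ℝ) (hH : H ∈ channelClass)
    (p q : ℤ) (hq : q ≠ 0) (hpq : Int.gcd p q = 1)
    (hratio : H 0 1 / H 1 0 * (H 1 2 / H 2 1) * (H 2 0 / H 0 2) = (p : ℝ) / (q : ℝ))
    (P σ : Fin 3 → ℝ) (hP : ∀ i, 0 < P i) (hσ : ∀ i, 0 < σ i)
    (hstrong :
      (H 0 1 ^ 2 ≥ (p : ℝ) ^ 2 * ((P 0 + σ 0 ^ 2) / σ 1 ^ 2) ∧
        H 0 2 ^ 2 ≥ (P 0 + σ 0 ^ 2) / σ 2 ^ 2 ∧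
        H 1 0 ^ 2 ≥ (q : ℝ) ^ 2 * ((P 1 + σ 1 ^ 2) / σ 0 ^ 2) ∧
        H 1 2 ^ 2 ≥ (P 1 + σ 1 ^ 2) / σ 2 ^ 2 ∧
        H 2 0 ^ 2 ≥ (P 2 + σ 2 ^ 2) / σ 0 ^ 2 ∧
        H 2 1 ^ 2 ≥ (P 2 + σ 2 ^ 2) / σ 1 ^ 2) ∨
      (H 0 1 ^ 2 ≥ (P 0 + σ 0 ^ 2) / σ 1 ^ 2 ∧
        H 0 2 ^ 2 ≥ (P 0 + σ 0 ^ 2) / σ 2 ^ 2 ∧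
        H 1 0 ^ 2 ≥ (P 1 + σ 1 ^ 2) / σ 0 ^ 2 ∧
        H 1 2 ^ 2 ≥ (p : ℝ) ^ 2 * ((P 1 + σ 1 ^ 2) / σ 2 ^ 2) ∧
        H 2 0 ^ 2 ≥ (P 2 + σ 2 ^ 2) / σ 0 ^ 2 ∧
        H 2 1 ^ 2 ≥ (q : ℝ) ^ 2 * ((P 2 + σ 2 ^ 2) / σ 1 ^ 2)) ∨
      (H 0 1 ^ 2 ≥ (P 0 + σ 0 ^ 2) / σ 1 ^ 2 ∧
        H 0 2 ^ 2 ≥ (q : ℝ) ^ 2 * ((P 0 + σ 0 ^ 2) / σ 2 ^ 2) ∧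
        H 1 0 ^ 2 ≥ (P 1 + σ 1 ^ 2) / σ 0 ^ 2 ∧
        H 1 2 ^ 2 ≥ (P 1 + σ 1 ^ 2) / σ 2 ^ 2 ∧
        H 2 0 ^ 2 ≥ (p : ℝ) ^ 2 * ((P 2 + σ 2 ^ 2) / σ 0 ^ 2) ∧
        H 2 1 ^ 2 ≥ (P 2 + σ 2 ^ 2) / σ 1 ^ 2)) :
    (∀ R : Fin 3 → ℝ,
      (∀ i, 0 ≤ R i ∧ R i ≤ max 0 (1 / 2 * Real.logb 2 (P i / σ i ^ 2))) →
        Achievable H P σ R) ∧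
    (∀ R : Fin 3 → ℝ, Achievable H P σ R →
      ∀ i, R i ≤ max 0 (1 / 2 * Real.logb 2 (P i / σ i ^ 2)) + 1 / 2) := by
  obtain ⟨hd, hH10, hH21, hH02, -⟩ := hH
  refine ⟨fun R hR => ?_, fun R hR i =>
    (hR.le_capacity hd hP hσ i).trans (half_logb_one_add_le (hP i) (hσ i))⟩
  have hq' : (q : ℝ) ≠ 0 := by exact_mod_cast hq
  have hprod : H 0 1 * H 1 2 * H 2 0 * q = p * (H 1 0 * H 2 1 * H 0 2) := by
    field_simp at hratio
    linarith
  have hne : ∀ j k l, H j k ^ 2 ≥ (P j + σ j ^ 2) / σ l ^ 2 → H j k ≠ 0 := by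
    intro j k l h h0
    have h1 := hP j
    have h2 := hσ l
    have h3 : 0 < (P j + σ j ^ 2) / σ l ^ 2 := by positivity
    rw [h0] at h
    linarith
  have hone : ∀ x y : ℝ, x ≥ y → ((1 : ℤ) : ℝ) ^ 2 * y ≤ x := fun x y h => by simpa using h
  -- Each set of inequalities leaves two of `H 0 1`, `H 1 2`, `H 2 0` nonzero; these determine the
  -- scales through two of the alignment equations, and `hprod` yields the third, even for `p = 0`.
  rcases hstrong with ⟨h01, h02, h10, h12, h20, h21⟩ | ⟨h01, h02, h10, h12, h20, h21⟩ |
    ⟨h01, h02, h10, h12, h20, h21⟩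
  · have hH12 := hne _ _ _ h12
    have hH20 := hne _ _ _ h20
    refine achievable_of_alignment_equations hd hP hσ ![1, H 2 0 / H 2 1, H 1 0 / (q * H 1 2)]
      (fun k => ?_) ![![0, p, 1], ![q, 0, 1], ![1, 1, 0]] (fun j => ?_) hH10 hH21 hH02 hq
      one_ne_zero one_ne_zero ?_ ?_ ?_ (fun j k hjk => ?_) hR
    · fin_cases k
      · exact one_ne_zero
      · exact div_ne_zero hH20 hH21
      · exact div_ne_zero hH10 (mul_ne_zero hq' hH12)
    · fin_cases j <;> rfl
    · simp only [Matrix.cons_val]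
      push_cast
      field_simp
      linarith
    · simp only [Matrix.cons_val]
      push_cast
      field_simp
    · simp only [Matrix.cons_val]
      push_cast
      field_simp
    · fin_cases j <;> fin_cases k <;> first
        | exact absurd rfl hjk
        | assumption
        | exact hone _ _ (by assumption)
  · have hH01 := hne _ _ _ h01
    have hH20 := hne _ _ _ h20
    refine achievable_of_alignment_equations hd hP hσ
      ![1, q * H 2 0 / H 2 1, q * H 0 1 * H 2 0 / (H 0 2 * H 2 1)]
      (fun k => ?_) ![![0, 1, 1], ![1, 0, p], ![1, q, 0]] (fun j => ?_) hH10 hH21 hH02 one_ne_zero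
      hq one_ne_zero ?_ ?_ ?_ (fun j k hjk => ?_) hR
    · fin_cases k
      · exact one_ne_zero
      · exact div_ne_zero (mul_ne_zero hq' hH20) hH21
      · exact div_ne_zero (mul_ne_zero (mul_ne_zero hq' hH01) hH20) (mul_ne_zero hH02 hH21)
    · fin_cases j <;> rfl
    · simp only [Matrix.cons_val]
      push_cast
      field_simp
    · simp only [Matrix.cons_val]
      push_cast
      field_simp
      linarith
    · simp only [Matrix.cons_val]
      push_cast
      field_simp
    · fin_cases j <;> fin_cases k <;> first
        | exact absurd rfl hjk
        | assumption
        | exact hone _ _ (by assumption)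
  · have hH01 := hne _ _ _ h01
    have hH12 := hne _ _ _ h12
    refine achievable_of_alignment_equations hd hP hσ
      ![q * H 0 1 * H 1 2 / (H 0 2 * H 1 0), 1, q * H 0 1 / H 0 2]
      (fun k => ?_) ![![0, 1, q], ![1, 0, 1], ![p, 1, 0]] (fun j => ?_) hH10 hH21 hH02 one_ne_zero
      one_ne_zero hq ?_ ?_ ?_ (fun j k hjk => ?_) hR
    · fin_cases k
      · exact div_ne_zero (mul_ne_zero (mul_ne_zero hq' hH01) hH12) (mul_ne_zero hH02 hH10)
      · exact one_ne_zero
      · exact div_ne_zero (mul_ne_zero hq' hH01) hH02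
    · fin_cases j <;> rfl
    · simp only [Matrix.cons_val]
      push_cast
      field_simp
    · simp only [Matrix.cons_val]
      push_cast
      field_simp
    · simp only [Matrix.cons_val]
      push_cast
      field_simp
      linarith
    · fin_cases j <;> fin_cases k <;> first
        | exact absurd rfl hjk
        | assumption
        | exact hone _ _ (by assumption)
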